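/- **Definitions.** Let $\mathsf A$ be an abelian category. A full subcategory $\mathsf E\subset\mathsf A$ is *coresolving* if it is closed under extensions, cokernels of monomorphisms and direct summands in $\mathsf A$, and every object of $\mathsf A$ admits a monomorphism into an object of $\mathsf E$. Dually, a full subcategory $\mathsf F$ of an abelian category $\mathsf B$ is *resolving* if it is closed under extensions, kernels of epimorphisms and direct summands, and every object of $\mathsf B$ is a quotient of an object of $\mathsf F$. Such a subcategory is regarded as an exact category whose admissible short exact sequences are the short exact sequences of the ambient abelian category with all three terms in the subcategory. A complex $E^\bullet$ over an exact category $\mathsf E$ is *acyclic* if there are admissible short exact sequences $0\to Z^n\to E^n\to Z^{n+1}\to 0$ in $\mathsf E$ for all $n\in\mathbb Z$ such that each differential $E^n\to E^{n+1}$ is the composition $E^n\to Z^{n+1}\to E^{n+1}$. The unbounded derived category $\mathsf D(\mathsf E)$ is the Verdier quotient of the homotopy category of unbounded complexes over $\mathsf E$ by the full subcategory of complexes homotopy equivalent to acyclic ones. For $\mathsf E\subset\mathsf A$ coresolving, write $H^n_{\mathsf A}(E^\bullet)$ for the cohomology objects, in $\mathsf A$, of a complex $E^\bullet$ over $\mathsf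 E$. Let $\mathsf D^{\le0}_{\mathsf A}(\mathsf E)\subset\mathsf D(\mathsf E)$ be the full subcategory of complexes $E^\bullet$ with $H^n_{\mathsf A}(E^\bullet)=0$ for all $n>0$, and let $\mathsf D^{\ge0}(\mathsf E)\subset\mathsf D(\mathsf E)$ be the full subcategory of objects that can be represented by complexes over $\mathsf E$ with $E^n=0$ for all $n<0$. For $\mathsf F\subset\mathsf B$ resolving, let $\mathsf D^{\le0}(\mathsf F)\subset\mathsf D(\mathsf F)$ be the full subcategory of objects that can be represented by complexes over $\mathsf F$ with $F^n=0$ for all $n>0$, and let $\mathsf D^{\ge0}_{\mathsf B}(\mathsf F)\subset\mathsf D(\mathsf F)$ be the full subcategory of complexes $F^\bullet$ with $H^n_{\mathsf B}(F^\bullet)=0$ for all $n<0$. In both cases put $\mathsf D^{\le n}=\mathsf D^{\le0}[-n]$ and $\mathsf D^{\ge n}=\mathsf D^{\ge0}[-n]$ for $n\in\mathbb Z$. A t-structure on a triangulated category $\mathsf D$ with (abelian) heart $\mathsf H=\mathsf D^{\le0}\cap\mathsf D^{\ge0}$ is *of the derived type* if the canonical maps $$\theta^i(X,Y)\colon \operatorname{Ext}^i_{\mathsf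 H}(X,Y)\longrightarrow\operatorname{Hom}_{\mathsf D}(X,Y[i])$$ are isomorphisms for all $X,Y\in\mathsf H$ and $i\ge0$. Here $\theta^0$ is the inclusion $\operatorname{Hom}_{\mathsf H}(X,Y)\to\operatorname{Hom}_{\mathsf D}(X,Y)$, the maps $\theta^i$ are additive and compatible with compositions, and $\theta^1$ sends the class of a short exact sequence $0\to X'\to X\to X''\to0$ in $\mathsf H$ to the unique morphism $X''\to X'[1]$ that makes $X'\to X\to X''\to X'[1]$ a distinguished triangle. **Proposition.** (1) Let $\mathsf A$ be an abelian category and let $\mathsf E\subset\mathsf A$ be a coresolving subcategory. Then the pair of full subcategories $(\mathsf D^{\le0}_{\mathsf A}(\mathsf E),\,\mathsf D^{\ge0}(\mathsf E))$ is a t-structure on $\mathsf D(\mathsf E)$. It is of the derived type, and the functor $\mathsf D(\mathsf E)\to\mathsf D(\mathsf A)$ induced by the embedding $\mathsf E\to\mathsf A$ identifies its heart with $\mathsf A$; that is, the restriction of this functor to the heart is isomorphic to the composition of an equivalence from the heart to $\mathsf A$ with the canonical embedding $\mathsf A\to\mathsf D(\mathsf A)$ in cohomological degree $0$. (2) Dually,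 let $\mathsf B$ be an abelian category and let $\mathsf F\subset\mathsf B$ be a resolving subcategory. Then the pair of full subcategories $(\mathsf D^{\le0}(\mathsf F),\,\mathsf D^{\ge0}_{\mathsf B}(\mathsf F))$ is a t-structure on $\mathsf D(\mathsf F)$. It is of the derived type, and the functor $\mathsf D(\mathsf F)\to\mathsf D(\mathsf B)$ induced by the embedding $\mathsf F\to\mathsf B$ identifies its heart with $\mathsf B$ in the same sense. -/

import Mathlib

open CategoryTheory Category Limits Pretriangulated Triangulated

universe w v u

noncomputable section

namespace ExactDerived

variable {A : Type u} [Category.{v} A] [Abelian A]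

/-- A coresolving subcategory of an abelian category: a full subcategory closed under extensions,
direct summands and cokernels of monomorphisms, and cogenerating. -/
class IsCoresolving (P : ObjectProperty A) : Prop extends
    P.IsClosedUnderExtensions, P.IsStableUnderRetracts where
  prop_X₃_of_shortExact {S : ShortComplex A} (hS : S.ShortExact) (h₁ : P S.X₁) (h₂ : P S.X₂) :
    P S.X₃
  exists_mono (X : A) : ∃ (Y : A) (i : X ⟶ Y), P Y ∧ Mono i

/-- A resolving subcategory of an abelian category: a full subcategory closed under extensions,
direct summands and kernels of epimorphisms, and generating. -/
class IsResolving (P : ObjectProperty A) : Prop extends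
    P.IsClosedUnderExtensions, P.IsStableUnderRetracts where
  prop_X₁_of_shortExact {S : ShortComplex A} (hS : S.ShortExact) (h₂ : P S.X₂) (h₃ : P S.X₃) :
    P S.X₁
  exists_epi (X : A) : ∃ (Y : A) (p : Y ⟶ X), P Y ∧ Epi p

/-- A strictly full subcategory that contains zero and is closed under extensions. It carries the
exact structure whose conflations are the short exact sequences of `A` with terms in `P`. -/
class IsExactSubcategory (P : ObjectProperty A) : Prop extends
    P.ContainsZero, P.IsClosedUnderIsomorphisms, P.IsClosedUnderExtensions

open ZeroObject in
instance (P : ObjectProperty A) [IsCoresolving P] : IsExactSubcategory P where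
  exists_zero := by
    obtain ⟨Y, _, hY, _⟩ := IsCoresolving.exists_mono (P := P) 0
    exact ⟨0, isZero_zero _, P.prop_of_retract ((isZero_zero A).retract Y) hY⟩

open ZeroObject in
instance (P : ObjectProperty A) [IsResolving P] : IsExactSubcategory P where
  exists_zero := by
    obtain ⟨Y, _, hY, _⟩ := IsResolving.exists_epi (P := P) 0
    exact ⟨0, isZero_zero _, P.prop_of_retract ((isZero_zero A).retract Y) hY⟩

variable (P : ObjectProperty A) [IsExactSubcategory P]

instance : HasBinaryBiproducts P.FullSubcategory where
  has_binary_biproduct X Y := HasBinaryBiproduct.mk ⟨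
    { pt := ⟨X.obj ⊞ Y.obj, P.prop_biprod X.property Y.property⟩
      fst := P.homMk biprod.fst
      snd := P.homMk biprod.snd
      inl := P.homMk biprod.inl
      inr := P.homMk biprod.inr
      inl_fst := ObjectProperty.hom_ext _ biprod.inl_fst
      inl_snd := ObjectProperty.hom_ext _ biprod.inl_snd
      inr_fst := ObjectProperty.hom_ext _ biprod.inr_fst
      inr_snd := ObjectProperty.hom_ext _ biprod.inr_snd },
    isBinaryBilimitOfTotal _ (ObjectProperty.hom_ext _ biprod.total)⟩

/-- A complex with terms in `P`, viewed as a complex in the ambient abelian category. -/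
abbrev asComplex (K : CochainComplex P.FullSubcategory ℤ) : CochainComplex A ℤ :=
  (P.ι.mapHomologicalComplex (ComplexShape.up ℤ)).obj K

variable {P}

/-- The admissible short exact sequences of the exact category `P`: those sequences in `P` that are
short exact in the ambient abelian category. -/
def IsConflation (S : ShortComplex P.FullSubcategory) : Prop :=
  (S.map P.ι).ShortExact

/-- A complex `K` over the exact category `P` is acyclic if it is spliced from conflations
`Z n ⟶ K.X n ⟶ Z (n + 1)` of `P`. -/
def IsAcyclic (K : CochainComplex P.FullSubcategory ℤ) : Prop :=
  ∃ (Z : ℤ → P.FullSubcategory) (i : ∀ n, Z n ⟶ K.X n) (p : ∀ n, K.X n ⟶ Z (n + 1))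
    (w : ∀ n, i n ≫ p n = 0),
    (∀ n, IsConflation (ShortComplex.mk (i n) (p n) (w n))) ∧
      ∀ n, p n ≫ i (n + 1) = K.d n (n + 1)

lemma acyclic_of_factorization (L : CochainComplex A ℤ) (Z : ℤ → A) (i : ∀ n, Z n ⟶ L.X n)
    (p : ∀ n, L.X n ⟶ Z (n + 1)) (w : ∀ n, i n ≫ p n = 0)
    (hS : ∀ n, (ShortComplex.mk (i n) (p n) (w n)).ShortExact)
    (hd : ∀ n, p n ≫ i (n + 1) = L.d n (n + 1)) :
    L.Acyclic ∧ ∀ n, Nonempty (Z n ≅ L.cycles n) := by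
  have hi (n : ℤ) : Mono (i n) := (hS n).mono_f
  have hp (n : ℤ) : Epi (p n) := (hS n).epi_g
  have w' (n : ℤ) : i n ≫ L.d n (n + 1) = 0 := by
    rw [← hd n, reassoc_of% w n, zero_comp]
  have hker (n : ℤ) : Nonempty (IsLimit (KernelFork.ofι (i n) (w' n))) := by
    refine ⟨KernelFork.IsLimit.ofι' _ _ fun {B} k hk ↦ ?_⟩
    have hk' : k ≫ p n = 0 := by
      rw [← cancel_mono (i (n + 1)), assoc, hd, hk, zero_comp]
    have : Mono (ShortComplex.mk (i n) (p n) (w n)).f := hi n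
    exact ⟨(hS n).exact.lift k hk', (hS n).exact.lift_f k hk'⟩
  constructor
  · intro n
    obtain ⟨m, rfl⟩ : ∃ m, m + 1 = n := ⟨n - 1, by lia⟩
    rw [HomologicalComplex.exactAt_iff' _ m (m + 1) (m + 1 + 1) (by simp) (by simp)]
    let φ : ShortComplex.mk (L.d m (m + 1)) (L.d (m + 1) (m + 1 + 1))
        (by simp) ⟶ ShortComplex.mk (i (m + 1)) (L.d (m + 1) (m + 1 + 1))
        (w' _) :=
      { τ₁ := p m, τ₂ := 𝟙 _, τ₃ := 𝟙 _, comm₁₂ := by simp [hd m], comm₂₃ := by simp }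
    have : Epi φ.τ₁ := hp m
    have : IsIso φ.τ₂ := by dsimp [φ]; infer_instance
    have : Mono φ.τ₃ := by dsimp [φ]; infer_instance
    exact (ShortComplex.exact_iff_of_epi_of_isIso_of_mono φ).2
      (ShortComplex.exact_of_f_is_kernel _ (hker (m + 1)).some)
  · intro n
    exact ⟨IsLimit.conePointUniqueUpToIso (hker n).some (L.cyclesIsKernel n (n + 1) (by simp))⟩

lemma epi_toCycles_of_exactAt (L : CochainComplex A ℤ) (n m : ℤ) (hnm : n + 1 = m)
    (h : L.ExactAt m) : Epi (L.toCycles n m) := by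
  obtain rfl : n = (ComplexShape.up ℤ).prev m := by simp; lia
  have := (L.sc m).exact_iff_epi_toCycles.1 h
  have e : L.toCycles ((ComplexShape.up ℤ).prev m) m = (L.sc m).toCycles := by
    exact (cancel_mono (L.iCycles m)).1 ((L.toCycles_i _ _).trans (L.sc m).toCycles_i.symm)
  rw [e]
  exact this

lemma iCycles_toCycles (L : CochainComplex A ℤ) (n m : ℤ) :
    L.iCycles n ≫ L.toCycles n m = 0 := by
  rw [← cancel_mono (L.iCycles m)]; simp

lemma shortExact_cycles (L : CochainComplex A ℤ) (hL : L.Acyclic) (n : ℤ) :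
    (ShortComplex.mk _ _ (iCycles_toCycles L n (n + 1))).ShortExact := by
  refine ShortComplex.ShortExact.mk' ?_ ?_ ?_
  · refine ShortComplex.exact_of_f_is_kernel _ (KernelFork.IsLimit.ofι' _ _ fun {B} k hk ↦ ?_)
    have hk' : k ≫ L.d n (n + 1) = 0 := by
      dsimp at k hk
      rw [← L.toCycles_i, reassoc_of% hk, zero_comp]
    exact ⟨L.liftCycles k (n + 1) (by simp) hk', L.liftCycles_i _ _ _ _⟩
  · dsimp; infer_instance
  · exact epi_toCycles_of_exactAt L n _ rfl (hL _)

lemma isAcyclic_iff (K : CochainComplex P.FullSubcategory ℤ) :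
    IsAcyclic K ↔ (asComplex P K).Acyclic ∧ ∀ n, P ((asComplex P K).cycles n) := by
  constructor
  · rintro ⟨Z, i, p, w, hS, hd⟩
    have h := acyclic_of_factorization (asComplex P K) (fun n ↦ (Z n).obj) (fun n ↦ (i n).hom)
      (fun n ↦ (p n).hom) (fun n ↦ P.ι.congr_map (w n)) hS
      (fun n ↦ P.ι.congr_map (hd n))
    exact ⟨h.1, fun n ↦ P.prop_of_iso (h.2 n).some (Z n).property⟩
  · rintro ⟨hK, hP⟩
    exact ⟨fun n ↦ ⟨(asComplex P K).cycles n, hP n⟩,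
      fun n ↦ P.homMk ((asComplex P K).iCycles n),
      fun n ↦ P.homMk ((asComplex P K).toCycles n (n + 1)),
      fun n ↦ ObjectProperty.hom_ext _ (iCycles_toCycles _ _ _),
      fun n ↦ shortExact_cycles _ hK n,
      fun n ↦ ObjectProperty.hom_ext _ ((asComplex P K).toCycles_i n (n + 1))⟩

lemma cycles_extension (S : ShortComplex (CochainComplex A ℤ)) (hS : S.ShortExact)
    (h₁ : S.X₁.Acyclic) (h₃ : S.X₃.Acyclic) :
    S.X₂.Acyclic ∧ ∀ n, (ShortComplex.mk (HomologicalComplex.cyclesMap S.f n)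
      (HomologicalComplex.cyclesMap S.g n) (by rw [← HomologicalComplex.cyclesMap_comp, S.zero,
        HomologicalComplex.cyclesMap_zero])).ShortExact := by
  have := hS.mono_f
  have := hS.epi_g
  refine ⟨fun n ↦ ?_, fun n ↦ ?_⟩
  · rw [HomologicalComplex.exactAt_iff_isZero_homology]
    exact (hS.homology_exact₂ n).isZero_of_both_isZero (h₁ n).isZero_homology
      (h₃ n).isZero_homology
  · refine ShortComplex.ShortExact.mk' (HomologicalComplex.cycles_left_exact S hS.exact n) ?_ ?_
    · dsimp; infer_instance
    · dsimp
      have h := epi_toCycles_of_exactAt S.X₃ (n - 1) n (by lia) (h₃ n)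
      have h' : Epi (S.g.f (n - 1)) := inferInstance
      have fac : S.X₂.toCycles (n - 1) n ≫ HomologicalComplex.cyclesMap S.g n =
          S.g.f (n - 1) ≫ S.X₃.toCycles (n - 1) n := by
        rw [← cancel_mono (S.X₃.iCycles n)]; simp
      have : Epi (S.X₂.toCycles (n - 1) n ≫ HomologicalComplex.cyclesMap S.g n) := by
        rw [fac]; infer_instance
      exact epi_of_epi (S.X₂.toCycles (n - 1) n) _


lemma isAcyclic_shift (K : CochainComplex P.FullSubcategory ℤ) (a : ℤ) (hK : IsAcyclic K) :
    IsAcyclic (K⟦a⟧) := by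
  rw [isAcyclic_iff] at hK ⊢
  have e (n : ℤ) : (asComplex P (K⟦a⟧)).sc n ≅ (asComplex P K).sc (a + n) :=
    (HomologicalComplex.shortComplexFunctor A (ComplexShape.up ℤ) n).mapIso
      (((P.ι.mapHomologicalComplex (ComplexShape.up ℤ)).commShiftIso a).app K) ≪≫
    (CochainComplex.shiftShortComplexFunctorIso A a n (a + n) rfl).app (asComplex P K)
  exact ⟨fun n ↦ (ShortComplex.exact_iff_of_iso (e n)).2 (hK.1 (a + n)),
    fun n ↦ P.prop_of_iso (ShortComplex.cyclesMapIso (e n)).symm (hK.2 (a + n))⟩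

lemma isAcyclic_of_isZero (K : CochainComplex P.FullSubcategory ℤ) (hK : IsZero K) :
    IsAcyclic K := by
  rw [isAcyclic_iff]
  have h : IsZero (asComplex P K) := Functor.map_isZero _ hK
  exact ⟨HomologicalComplex.acyclic_of_isZero _ h, fun n ↦ P.prop_of_isZero
    (Functor.map_isZero (HomologicalComplex.cyclesFunctor A (ComplexShape.up ℤ) n) h)⟩

lemma isAcyclic_mappingCone {K L : CochainComplex P.FullSubcategory ℤ} (f : K ⟶ L)
    (hK : IsAcyclic K) (hL : IsAcyclic L) : IsAcyclic (CochainComplex.mappingCone f) := by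
  let S := CochainComplex.mappingCone.triangleRotateShortComplex f
  let T := S.map (P.ι.mapHomologicalComplex (ComplexShape.up ℤ))
  have hT : T.ShortExact := by
    apply HomologicalComplex.shortExact_of_degreewise_shortExact
    intro n
    exact ((CochainComplex.mappingCone.triangleRotateShortComplexSplitting f n).map P.ι).shortExact
  have h₁ := (isAcyclic_iff L).1 hL
  have h₃ := (isAcyclic_iff _).1 (isAcyclic_shift K 1 hK)
  obtain ⟨h, h'⟩ := cycles_extension T hT h₁.1 h₃.1
  rw [isAcyclic_iff]
  exact ⟨h, fun n ↦ P.prop_X₂_of_shortExact (h' n) (h₁.2 n) (h₃.2 n)⟩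

variable (P)

/-- The full subcategory of the homotopy category of complexes over `P` formed by the complexes
that are homotopy equivalent to an acyclic complex. -/
def acyclic : ObjectProperty (HomotopyCategory P.FullSubcategory (ComplexShape.up ℤ)) :=
  fun X ↦ ∃ K : CochainComplex P.FullSubcategory ℤ, IsAcyclic K ∧
    Nonempty (X ≅ (HomotopyCategory.quotient _ _).obj K)

instance : (acyclic P).IsClosedUnderIsomorphisms where
  of_iso := fun e ⟨K, hK, ⟨e'⟩⟩ ↦ ⟨K, hK, ⟨e.symm ≪≫ e'⟩⟩

open ZeroObject in
instance : (acyclic P).ContainsZero where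
  exists_zero := ⟨(HomotopyCategory.quotient _ _).obj (0 : CochainComplex P.FullSubcategory ℤ),
    Functor.map_isZero _ (isZero_zero _), _, isAcyclic_of_isZero _ (isZero_zero _),
    ⟨Iso.refl _⟩⟩

instance : (acyclic P).IsStableUnderShift ℤ where
  isStableUnderShiftBy a :=
    { le_shift := fun X ⟨K, hK, ⟨e⟩⟩ ↦ ⟨K⟦a⟧, isAcyclic_shift K a hK,
        ⟨(shiftFunctor _ a).mapIso e ≪≫
          ((HomotopyCategory.quotient _ _).commShiftIso a).symm.app K⟩⟩ }

instance : (acyclic P).IsTriangulatedClosed₃ := .mk' (by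
  rintro T hT ⟨K, hK, ⟨e₁⟩⟩ ⟨L, hL, ⟨e₂⟩⟩
  obtain ⟨f, hf⟩ := (HomotopyCategory.quotient _ _).map_surjective (e₁.inv ≫ T.mor₁ ≫ e₂.hom)
  have hT' := HomotopyCategory.mappingCone_triangleh_distinguished f
  exact ⟨_, isAcyclic_mappingCone f hK hL, ⟨Triangle.π₃.mapIso
    (isoTriangleOfIso₁₂ T _ hT hT' e₁ e₂
      ((e₁.hom_inv_id_assoc _).symm.trans (congr_arg (e₁.hom ≫ ·) hf.symm)))⟩⟩)

instance : (acyclic P).IsTriangulated where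
  toIsTriangulatedClosed₂ := .of_isTriangulatedClosed₃

/-- The unbounded derived category of the exact category `P`: the Verdier quotient of the unbounded
homotopy category of complexes over `P` by the acyclic complexes. -/
abbrev DerivedCat : Type _ := (acyclic P).trW.Localization

/-- The localization functor from the homotopy category. -/
abbrev Qh : HomotopyCategory P.FullSubcategory (ComplexShape.up ℤ) ⥤ DerivedCat P := (acyclic P).trW.Q

/-- The functor that sends a complex over `P` to the object it represents. -/
abbrev Q : CochainComplex P.FullSubcategory ℤ ⥤ DerivedCat P := HomotopyCategory.quotient _ _ ⋙ Qh P

section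
variable [HasDerivedCategory.{w} A]

/-- The functor induced by the inclusion of `P` on homotopy categories of complexes, followed by the
localization functor to the derived category of `A`. -/
def toDh : HomotopyCategory P.FullSubcategory (ComplexShape.up ℤ) ⥤ DerivedCategory A :=
  P.ι.mapHomotopyCategory (ComplexShape.up ℤ) ⋙ DerivedCategory.Qh

lemma inverts : (acyclic P).trW.IsInvertedBy (toDh P) := by
  rintro X Y f ⟨Z, g, h, hT, K, hK, ⟨e⟩⟩
  let F := P.ι.mapHomotopyCategory (ComplexShape.up ℤ)
  have hF : (HomotopyCategory.subcategoryAcyclic A).trW (F.map f) :=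
    ObjectProperty.trW.mk _ (F.map_distinguished _ hT)
      (ObjectProperty.prop_of_iso _ (F.mapIso e).symm
        ((HomotopyCategory.quotient_obj_mem_subcategoryAcyclic_iff_acyclic
          (asComplex P K)).2 ((isAcyclic_iff K).1 hK).1))
  exact Localization.inverts DerivedCategory.Qh _ _ hF

/-- The functor from the derived category of the exact category `P` to the derived category of the
ambient abelian category that is induced by the inclusion. -/
def toDerived : DerivedCat P ⥤ DerivedCategory A := Localization.lift (toDh P) (inverts P) (Qh P)

end

/-- The objects of the derived category of `P` whose cohomology, computed in `A`, vanishes in all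
degrees `n > 0`. -/
def cohLE : ObjectProperty (DerivedCat P) := fun X ↦
  ∃ K : CochainComplex P.FullSubcategory ℤ, Nonempty (X ≅ (Q P).obj K) ∧
    ∀ n : ℤ, 0 < n → IsZero ((asComplex P K).homology n)

/-- The objects of the derived category of `P` whose cohomology, computed in `A`, vanishes in all
degrees `n < 0`. -/
def cohGE : ObjectProperty (DerivedCat P) := fun X ↦
  ∃ K : CochainComplex P.FullSubcategory ℤ, Nonempty (X ≅ (Q P).obj K) ∧
    ∀ n : ℤ, n < 0 → IsZero ((asComplex P K).homology n)

/-- The objects of the derived category of `P` that are represented by a complex over `P` whose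
terms vanish in all degrees `n > 0`. -/
def strictLE : ObjectProperty (DerivedCat P) := fun X ↦
  ∃ K : CochainComplex P.FullSubcategory ℤ, Nonempty (X ≅ (Q P).obj K) ∧
    ∀ n : ℤ, 0 < n → IsZero (K.X n)

/-- The objects of the derived category of `P` that are represented by a complex over `P` whose
terms vanish in all degrees `n < 0`. -/
def strictGE : ObjectProperty (DerivedCat P) := fun X ↦
  ∃ K : CochainComplex P.FullSubcategory ℤ, Nonempty (X ≅ (Q P).obj K) ∧
    ∀ n : ℤ, n < 0 → IsZero (K.X n)

end ExactDerived

namespace HeartComparison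

variable {C : Type u} [Category.{v} C] [Preadditive C] [HasZeroObject C] [HasShift C ℤ]
  [∀ (n : ℤ), (shiftFunctor C n).Additive] [Pretriangulated C]
  (t : TStructure C)

open ZeroObject in
instance : t.heart.ContainsZero where
  exists_zero := ⟨0, isZero_zero C, by
    rw [t.mem_heart_iff]
    constructor <;> infer_instance⟩

lemma heart_of_triangle (T : Triangle C) (hT : T ∈ distTriang C) (h₁ : t.heart T.obj₁)
    (h₃ : t.heart T.obj₃) : t.heart T.obj₂ := by
  rw [t.mem_heart_iff] at *
  exact ⟨t.isLE₂ T hT 0 h₁.1 h₃.1, t.isGE₂ T hT 0 h₁.2 h₃.2⟩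

instance : HasBinaryBiproducts t.heart.FullSubcategory where
  has_binary_biproduct X Y :=
    have : HasBinaryBiproducts C := inferInstance
    HasBinaryBiproduct.mk ⟨
    { pt := ⟨X.obj ⊞ Y.obj, heart_of_triangle t _
        (binaryBiproductTriangle_distinguished X.obj Y.obj) X.property Y.property⟩
      fst := t.heart.homMk biprod.fst
      snd := t.heart.homMk biprod.snd
      inl := t.heart.homMk biprod.inl
      inr := t.heart.homMk biprod.inr
      inl_fst := ObjectProperty.hom_ext _ biprod.inl_fst
      inl_snd := ObjectProperty.hom_ext _ biprod.inl_snd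
      inr_fst := ObjectProperty.hom_ext _ biprod.inr_fst
      inr_snd := ObjectProperty.hom_ext _ biprod.inr_snd },
    isBinaryBilimitOfTotal _ (ObjectProperty.hom_ext _ biprod.total)⟩

instance : HasFiniteProducts t.heart.FullSubcategory :=
  have : HasTerminal t.heart.FullSubcategory := HasZeroObject.hasTerminal
  hasFiniteProducts_of_has_binary_and_terminal

lemma admissible {X₁ X₂ : t.heart.FullSubcategory} (f : X₁ ⟶ X₂) :
    AbelianSubcategory.admissibleMorphism t.heart.ι f := by
  intro X₃ f₂ f₃ hT
  obtain ⟨hX₁, hX₁'⟩ := (t.mem_heart_iff _).1 X₁.property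
  obtain ⟨hX₂, hX₂'⟩ := (t.mem_heart_iff _).1 X₂.property
  have h₁ := t.isLE_shift X₁.obj 0 1 (-1) (by lia)
  have h₁' := t.isGE_shift X₁.obj 0 1 (-1) (by lia)
  have hX₃ : t.IsLE X₃ 0 := t.isLE₂ _ (rot_of_distTriang _ hT) 0 hX₂
    (t.isLE_of_le (X₁.obj⟦(1 : ℤ)⟧) (-1) 0 (by lia))
  have hX₃' : t.IsGE X₃ (-1) := t.isGE₂ _ (rot_of_distTriang _ hT) (-1)
    (t.isGE_of_ge X₂.obj (-1) 0 (by lia)) h₁'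
  obtain ⟨U, V, hU, hV, a, b, c, hUV⟩ := t.exists_triangle X₃ (-1) 0 (by lia)
  have hU : t.IsLE U (-1) := ⟨hU⟩
  have hV : t.IsGE V 0 := ⟨hV⟩
  have hV' : t.IsLE V 0 := t.isLE₂ _ (rot_of_distTriang _ hUV) 0 hX₃ (by
    have := t.isLE_shift U (-1) 1 (-2) (by lia)
    exact t.isLE_of_le (U⟦(1 : ℤ)⟧) (-2) 0 (by lia))
  have hU' : t.IsGE U (-1) := t.isGE₂ _ (inv_rot_of_distTriang _ hUV) (-1) (by
    have := t.isGE_shift V 0 (-1) 1 (by lia)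
    exact t.isGE_of_ge (V⟦(-1 : ℤ)⟧) (-1) 1 (by lia)) hX₃'
  have hK : t.heart (U⟦(-1 : ℤ)⟧) := (t.mem_heart_iff _).2
    ⟨t.isLE_shift U (-1) (-1) 0 (by lia), t.isGE_shift U (-1) (-1) 0 (by lia)⟩
  have e : (U⟦(-1 : ℤ)⟧)⟦(1 : ℤ)⟧ ≅ U := (shiftEquiv C (1 : ℤ)).counitIso.app U
  have h₀ (c : V ⟶ U⟦(1 : ℤ)⟧) : (c ≫ e.inv⟦(1 : ℤ)⟧') ≫ e.hom⟦(1 : ℤ)⟧' = c := by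
    rw [assoc, ← Functor.map_comp, e.inv_hom_id, CategoryTheory.Functor.map_id, comp_id]
  exact ⟨⟨_, hK⟩, ⟨V, (t.mem_heart_iff _).2 ⟨hV', hV⟩⟩, e.hom ≫ a, b, c ≫ e.inv⟦(1 : ℤ)⟧',
    isomorphic_distinguished _ hUV _ (Triangle.isoMk _ _ e (Iso.refl _) (Iso.refl _)
      (comp_id _) ((comp_id _).trans (id_comp _).symm) ((h₀ c).trans (id_comp _).symm))⟩

/-- The heart of a t-structure is an abelian category; its additive structure is that of `C`. -/
instance abelianHeart [IsTriangulated C] : Abelian t.heart.FullSubcategory :=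
  AbelianSubcategory.abelian (ι := t.heart.ι)
    (fun X Y n f hn ↦ by
      have h₁ := ((t.mem_heart_iff _).1 X.property).1
      have h₂ := ((t.mem_heart_iff _).1 Y.property).2
      have h₃ := t.isGE_shift Y.obj 0 n (-n) (by lia)
      exact t.zero_of_isLE_of_isGE f 0 (-n) (by lia) h₁ h₃)
    (by ext X Y f; simpa using admissible t f)

/-- The canonical comparison maps `θ` from the Yoneda Ext groups of the heart to the graded Hom groups
of `C`. In degree `0` the map is the inclusion of the heart, the maps are compatible with the
products, and the class of a short exact sequence `X₁ ⟶ X₂ ⟶ X₃` of the heart goes to the connecting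
morphism `X₃ ⟶ X₁⟦1⟧` of a distinguished triangle that extends it (there is exactly one, since
`Hom (X₁⟦1⟧) X₃ = 0`). As every class in positive degree is a product of classes of short exact
sequences, these conditions determine `θ`. -/
structure ExtComparison [IsTriangulated C] [HasExt.{w} t.heart.FullSubcategory] where
  /-- The comparison map in degree `i`. -/
  θ {X Y : t.heart.FullSubcategory} (i : ℕ) :
    Abelian.Ext.{w} X Y i →+ ShiftedHom X.obj Y.obj (i : ℤ)
  θ_mk₀ {X Y : t.heart.FullSubcategory} (f : X ⟶ Y) :
    θ 0 (Abelian.Ext.mk₀ f) = ShiftedHom.mk₀ ((0 : ℕ) : ℤ) Nat.cast_zero f.hom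
  θ_comp {X Y Z : t.heart.FullSubcategory} {a b c : ℕ} (h : a + b = c)
      (α : Abelian.Ext.{w} X Y a) (β : Abelian.Ext.{w} Y Z b) :
    θ c (α.comp β h) = (θ a α).comp (θ b β) (by lia)
  θ_extClass {S : ShortComplex t.heart.FullSubcategory} (hS : S.ShortExact) :
    Triangle.mk S.f.hom S.g.hom (θ 1 hS.extClass) ∈ distTriang C

/-- The t-structure is of the derived type: the canonical maps from Ext groups in the heart to
Hom groups in `C` are isomorphisms in all degrees. -/
def IsOfDerivedType [IsTriangulated C] : Prop :=
  letI : HasExt.{max u v} t.heart.FullSubcategory := HasExt.standard _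
  ∃ c : ExtComparison.{max u v} t, ∀ (X Y : t.heart.FullSubcategory) (i : ℕ),
    Function.Bijective (c.θ (X := X) (Y := Y) i)

end HeartComparison

end

/-! Let Φ denote `toDerived`, the functor from the derived category of the exact subcategory to that
of the ambient abelian category. In the coresolving case everything follows from one fact: Φ is
bijective on Hom(X, Y) as soon as Y is represented by a bounded below complex, with X arbitrary
(`toDerived_map_bijective_of_isStrictlyGE`). Indeed, a quasi-isomorphism from such a Y to any
complex Z over A forces Z to be cohomologically bounded below, so Z can be truncated and then
resolved by a bounded below complex M over E. The cone of Y ⟶ M is bounded below and exact in A, and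
closure under cokernels of monomorphisms makes it acyclic in the exact category E. Denominators in A
starting at Y are thus refined by denominators in E, and the calculus of fractions concludes.

The same resolutions show that Φ maps the strictly bounded below objects essentially onto the
coaisles of the standard t-structure, while `cohLE` is by construction the preimage of its aisle.
Truncation triangles therefore lift along Φ (`ofMapBijectiveToGE`). Moreover Φ is fully faithful on
t-bounded objects, hence restricts to an equivalence from the heart to A
(`exists_heart_equivalence`).

For the derived type property, Ext in the heart is Ext in A through this equivalence, which is Hom
in D(A), which is Hom in the original category by full faithfulness. The resulting bijections
satisfy the conditions on θ because these can be checked after applying Φ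
(`isOfDerivedType_of_heart_equivalence`). The resolving case is dual: there Hom(X, Y) is controlled
by X bounded above. -/

noncomputable section

/-! ### Exact two-term complexes -/

namespace HomologicalComplex

variable {A : Type u} [Category.{v} A] [Abelian A] {ι : Type*} {c : ComplexShape ι}

lemma exactAt_of_isZero_X (K : HomologicalComplex A c) (i : ι) (h : IsZero (K.X i)) :
    K.ExactAt i :=
  ShortComplex.exact_of_isZero_X₂ _ h

lemma quasiIso_f_of_acyclic_X₃ {S : ShortComplex (CochainComplex A ℤ)} (hS : S.ShortExact)
    (h : S.X₃.Acyclic) : QuasiIso S.f := by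
  rw [quasiIso_iff]
  intro i
  rw [quasiIsoAt_iff_isIso_homologyMap]
  have : Mono (homologyMap S.f i) :=
    (hS.homology_exact₁ (i - 1) i (by simp)).mono_g ((h (i - 1)).isZero_homology.eq_of_src _ _)
  have : Epi (homologyMap S.f i) :=
    (hS.homology_exact₂ i).epi_f ((h i).isZero_homology.eq_of_tgt _ _)
  exact isIso_of_mono_of_epi _

lemma acyclic_double_id (X : A) (n : ℤ) :
    (double (𝟙 X) (show (ComplexShape.up ℤ).Rel n (n + 1) from rfl)).Acyclic := by
  have h : (ComplexShape.up ℤ).Rel n (n + 1) := rfl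
  have hd := double_d (𝟙 X) h (by lia)
  have : IsIso ((double (𝟙 X) h).d n (n + 1)) := by rw [hd]; infer_instance
  intro i
  by_cases h₀ : i = n
  · subst h₀
    rw [exactAt_iff' _ (i - 1) i (i + 1) (by simp) (by simp)]
    exact (ShortComplex.exact_iff_mono _ (double_d_eq_zero₀ (𝟙 X) h _ _ (by lia))).2
      (inferInstanceAs (Mono ((double (𝟙 X) h).d i (i + 1))))
  by_cases h₁ : i = n + 1
  · subst h₁
    rw [exactAt_iff' _ n (n + 1) (n + 1 + 1) (by simp) (by simp)]
    exact (ShortComplex.exact_iff_epi _ (double_d_eq_zero₀ (𝟙 X) h _ _ (by lia))).2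
      (inferInstanceAs (Epi ((double (𝟙 X) h).d n (n + 1))))
  exact exactAt_of_isZero_X _ _ (isZero_double_X _ _ _ h₀ h₁)

/-- The map between the contractible complexes `X ⟶ X` and `Y ⟶ Y` in degrees `n` and `n + 1`. -/
def doubleIdMap {X Y : A} (f : X ⟶ Y) (n : ℤ) :
    double (𝟙 X) (show (ComplexShape.up ℤ).Rel n (n + 1) from rfl) ⟶
      double (𝟙 Y) (show (ComplexShape.up ℤ).Rel n (n + 1) from rfl) :=
  mkHomFromDouble _ (by lia) (f ≫ (doubleXIso₀ _ _).inv) (f ≫ (doubleXIso₁ _ _ (by lia)).inv)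
    (by simp [double_d _ _ (show n ≠ n + 1 by lia)])
    (fun k _ ↦ by rw [double_d_eq_zero₀ _ _ _ _ (by lia), comp_zero])

instance {X Y : A} (f : X ⟶ Y) [Mono f] (n : ℤ) : Mono (doubleIdMap f n) := by
  apply mono_of_mono_f
  intro i
  by_cases h₀ : i = n
  · subst h₀; simp only [doubleIdMap, mkHomFromDouble_f₀]; infer_instance
  by_cases h₁ : i = n + 1
  · subst h₁; simp only [doubleIdMap, mkHomFromDouble_f₁]; infer_instance
  exact ⟨fun _ _ _ ↦ (isZero_double_X _ _ _ h₀ h₁).eq_of_tgt _ _⟩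

end HomologicalComplex

/-! ### Resolutions of bounded complexes -/

namespace CochainComplex

open HomologicalComplex

variable {A : Type u} [Category.{v} A] [Abelian A]

/-- The pushout `b` of the monomorphism `t` is a monomorphism with the same cokernel, and that
cokernel is acyclic because both ends of `t` are. -/
lemma quasiIso_of_isPushout {K₁ K₂ L₁ L₂ : CochainComplex A ℤ} {t : K₁ ⟶ K₂} {l : K₁ ⟶ L₁}
    {r : K₂ ⟶ L₂} {b : L₁ ⟶ L₂} (sq : IsPushout t l r b) [Mono t] (h₁ : K₁.Acyclic)
    (h₂ : K₂.Acyclic) : QuasiIso b := by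
  have : Mono b := (MorphismProperty.monomorphisms _).of_isPushout sq.flip ‹Mono t›
  have hS (X Y : CochainComplex A ℤ) (f : X ⟶ Y) [Mono f] :
      (ShortComplex.mk f (cokernel.π f) (cokernel.condition f)).ShortExact :=
    { exact := ShortComplex.exact_cokernel f }
  have ht : QuasiIso t := by
    rw [quasiIso_iff]
    intro i
    rw [quasiIsoAt_iff_isIso_homologyMap]
    exact (h₁ i).isZero_homology.isIso (h₂ i).isZero_homology _
  have := isIso_cokernel_map_of_isPushout sq
  exact quasiIso_f_of_acyclic_X₃ (hS _ _ b) fun i ↦ ((hS _ _ t).acyclic_X₃ ht i).of_iso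
    (asIso (cokernel.map _ _ _ _ sq.w))

lemma isIso_f_of_isPushout {K₁ K₂ L₁ L₂ : CochainComplex A ℤ} {t : K₁ ⟶ K₂} {l : K₁ ⟶ L₁}
    {r : K₂ ⟶ L₂} {b : L₁ ⟶ L₂} (sq : IsPushout t l r b) (i : ℤ) (h : IsIso (t.f i)) :
    IsIso (b.f i) :=
  have : IsIso ((HomologicalComplex.eval A (ComplexShape.up ℤ) i).map t) := h
  (sq.map (HomologicalComplex.eval A (ComplexShape.up ℤ) i)).isIso_inr_of_isIso

/-- If every object embeds into an object satisfying `P`, then up to a quasi-isomorphism that is an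
isomorphism outside of the degrees `n` and `n + 1`, the degree `n` term of a complex may be assumed
to satisfy `P`. -/
lemma exists_quasiIso_prop_X (P : ObjectProperty A) [P.IsClosedUnderIsomorphisms]
    (hP : ∀ X : A, ∃ (Y : A) (i : X ⟶ Y), P Y ∧ Mono i) (L : CochainComplex A ℤ) (n : ℤ) :
    ∃ (M : CochainComplex A ℤ) (f : L ⟶ M), QuasiIso f ∧ P (M.X n) ∧
      ∀ i, i ≠ n → i ≠ n + 1 → IsIso (f.f i) := by
  obtain ⟨J, j, hJ, _⟩ := hP (L.X n)
  -- Pushing out along `l` glues `J` in place of `L.X n`: since `l` is the identity in degree `n`,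
  -- the pushout there is `J`, and since the two-term complexes vanish elsewhere only degrees `n`
  -- and `n + 1` change.
  let l : double (𝟙 (L.X n)) (show (ComplexShape.up ℤ).Rel n (n + 1) from rfl) ⟶ L :=
    mkHomFromDouble _ (by lia) (𝟙 _) (L.d n (n + 1)) (by simp) (by simp)
  have sq := IsPushout.of_hasPushout (doubleIdMap j n) l
  refine ⟨_, pushout.inr (doubleIdMap j n) l,
    quasiIso_of_isPushout sq (acyclic_double_id _ _) (acyclic_double_id _ _), ?_, ?_⟩
  · have : IsIso (l.f n) := by simp only [l, mkHomFromDouble_f₀]; infer_instance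
    have := isIso_f_of_isPushout sq.flip n this
    exact P.prop_of_iso ((doubleXIso₀ _ _).symm ≪≫
      asIso ((pushout.inl (doubleIdMap j n) l).f n)) hJ
  · intro i h₀ h₁
    exact isIso_f_of_isPushout sq i
      ((isZero_double_X _ _ _ h₀ h₁).isIso (isZero_double_X _ _ _ h₀ h₁) _)

/-- A sequence of complexes whose transition maps are eventually isomorphisms in each degree has a
limiting complex. -/
lemma exists_limit_of_eventually_isIso (F : ℕ ⥤ CochainComplex A ℤ) (n : ℤ)
    (hF : ∀ (a b : ℕ) (f : a ⟶ b) (i : ℤ), i < n + a → IsIso ((F.map f).f i))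
    (hF' : ∀ (a b : ℕ) (f : a ⟶ b), QuasiIso (F.map f)) :
    ∃ (M : CochainComplex A ℤ) (φ : F.obj 0 ⟶ M), QuasiIso φ ∧
      ∀ i, Nonempty (M.X i ≅ (F.obj (i + 1 - n).toNat).X i) := by
  -- The first stage `a` with `i < n + a`, from which on degree `i` no longer changes; it is `0`
  -- when `i < n`.
  let a (i : ℤ) : ℕ := (i + 1 - n).toNat
  let s (i : ℤ) : a i ⟶ a (i + 1) := homOfLE (Int.toNat_le_toNat (by lia))
  let X (i : ℤ) : A := (F.obj (a i)).X i
  let d (i : ℤ) : X i ⟶ X (i + 1) := (F.map (s i)).f i ≫ (F.obj (a (i + 1))).d i (i + 1)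
  have hφ (p q r : ℕ) (f : p ⟶ q) (g : q ⟶ r) (i : ℤ) :
      (F.map f).f i ≫ (F.map g).f i = (F.map (f ≫ g)).f i := by simp
  have hψ (i : ℤ) (p q : ℕ) (f : p ⟶ a (i + 1)) (g : a (i + 1) ⟶ q) :
      (F.map (f ≫ g)).f i ≫ (F.obj q).d i (i + 1) =
        ((F.map f).f i ≫ (F.obj (a (i + 1))).d i (i + 1)) ≫ (F.map g).f (i + 1) := by simp
  have hψ' (i : ℤ) (p q : ℕ) (f : p ⟶ q) (g : q ⟶ a (i + 1)) :
      (F.map f).f i ≫ (F.map g).f i ≫ (F.obj (a (i + 1))).d i (i + 1) =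
        (F.obj p).d i (i + 1) ≫ (F.map (f ≫ g)).f (i + 1) := by simp
  let M : CochainComplex A ℤ := CochainComplex.of X d (fun i ↦ by simp [d])
  have hd (i : ℤ) : M.d i (i + 1) = d i := CochainComplex.of_d ..
  let φ : F.obj 0 ⟶ M :=
    { f i := (F.map (homOfLE (Nat.zero_le (a i)))).f i
      comm' i j hij := by
        obtain rfl : j = i + 1 := hij.symm
        rw [hd]
        exact (hψ' i _ _ (homOfLE (Nat.zero_le (a i))) (s i)) }
  refine ⟨M, φ, ?_, fun i ↦ ⟨Iso.refl _⟩⟩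
  rw [quasiIso_iff]
  intro i
  obtain ⟨i, rfl⟩ : ∃ j, i = j + 1 := ⟨i - 1, by lia⟩
  rw [quasiIsoAt_iff' φ i (i + 1) (i + 1 + 1) (by simp) (by simp)]
  -- Stage `a (i + 1 + 1)` is stable in all three degrees involved, so `ψ` is an isomorphism, and
  -- `φ` followed by `ψ` is a transition map of the system, a quasi-isomorphism.
  let ψ : M.sc' i (i + 1) (i + 1 + 1) ⟶ (F.obj (a (i + 1 + 1))).sc' i (i + 1) (i + 1 + 1) :=
    { τ₁ := (F.map (s i ≫ s (i + 1))).f i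
      τ₂ := (F.map (s (i + 1))).f (i + 1)
      τ₃ := (F.map (𝟙 _)).f (i + 1 + 1)
      comm₁₂ := (hψ i _ _ (s i) (s (i + 1))).trans (congr_arg (· ≫ _) (hd i).symm)
      comm₂₃ := (hψ (i + 1) _ _ (s (i + 1)) (𝟙 _)).trans (congr_arg (· ≫ _) (hd (i + 1)).symm) }
  have h₁ : IsIso ψ.τ₁ := hF _ _ _ _ (by dsimp [a]; lia)
  have h₂ : IsIso ψ.τ₂ := hF _ _ _ _ (by dsimp [a]; lia)
  have h₃ : IsIso ψ.τ₃ := hF _ _ _ _ (by dsimp [a]; lia)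
  have : IsIso ψ := ShortComplex.isIso_of_isIso _
  have h := (quasiIsoAt_iff' (F.map (homOfLE (Nat.zero_le (a (i + 1 + 1))))) i (i + 1) (i + 1 + 1)
    (by simp) (by simp)).1 inferInstance
  have fac : (HomologicalComplex.shortComplexFunctor' A (ComplexShape.up ℤ) i (i + 1)
      (i + 1 + 1)).map φ ≫ ψ = (HomologicalComplex.shortComplexFunctor' A (ComplexShape.up ℤ) i
        (i + 1) (i + 1 + 1)).map (F.map (homOfLE (Nat.zero_le (a (i + 1 + 1))))) :=
    ShortComplex.hom_ext _ _ (hφ _ _ _ _ _ _) (hφ _ _ _ _ _ _) (hφ _ _ _ _ _ _)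
  rw [← fac] at h
  exact (ShortComplex.quasiIso_iff_comp_right _ ψ).1 h

/-- If every object embeds into an object satisfying `P`, then every bounded below complex has a
bounded below right resolution with terms in `P`. -/
lemma exists_right_resolution (P : ObjectProperty A) [P.IsClosedUnderIsomorphisms]
    [P.ContainsZero] (hP : ∀ X : A, ∃ (Y : A) (i : X ⟶ Y), P Y ∧ Mono i)
    (L : CochainComplex A ℤ) (n : ℤ) [L.IsStrictlyGE n] :
    ∃ (M : CochainComplex A ℤ) (φ : L ⟶ M), QuasiIso φ ∧ M.IsStrictlyGE n ∧ ∀ i, P (M.X i) := by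
  choose M f hq hP hf using exists_quasiIso_prop_X P hP
  -- Passing from stage `k` to stage `k + 1` repairs degree `n + k` and disturbs only degree `n + k
  -- + 1` besides, so from stage `a` on the degrees below `n + a` are fixed.
  let C (k : ℕ) : CochainComplex A ℤ := Nat.rec L (fun k K ↦ M K (n + k)) k
  let F : ℕ ⥤ CochainComplex A ℤ := Functor.ofSequence (X := C) (fun k ↦ f (C k) (n + k))
  have hF (a : ℕ) : F.map (homOfLE (Nat.le_succ a)) = f (C a) (n + a) :=
    Functor.ofSequence_map_homOfLE_succ _ _
  have hF₁ (a b : ℕ) (g : a ⟶ b) (i : ℤ) (hi : i < n + a) : IsIso ((F.map g).f i) := by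
    obtain ⟨k, rfl⟩ := Nat.exists_eq_add_of_le (leOfHom g)
    induction k with
    | zero =>
      obtain rfl : g = 𝟙 _ := Subsingleton.elim _ _
      rw [F.map_id]
      infer_instance
    | succ k hk =>
      have h := hk (homOfLE (by lia))
      have h' : IsIso ((F.map (homOfLE (Nat.le_succ (a + k)))).f i) := by
        rw [hF]
        exact hf _ _ _ (by push_cast; lia) (by push_cast; lia)
      obtain rfl : g = homOfLE (by lia : a ≤ a + k) ≫ homOfLE (Nat.le_succ (a + k)) :=
        Subsingleton.elim _ _
      rw [F.map_comp, HomologicalComplex.comp_f]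
      infer_instance
  have hF₂ (a b : ℕ) (g : a ⟶ b) : QuasiIso (F.map g) := by
    obtain ⟨k, rfl⟩ := Nat.exists_eq_add_of_le (leOfHom g)
    induction k with
    | zero =>
      obtain rfl : g = 𝟙 _ := Subsingleton.elim _ _
      rw [F.map_id]
      infer_instance
    | succ k hk =>
      have h := hk (homOfLE (by lia))
      have h' : QuasiIso (F.map (homOfLE (Nat.le_succ (a + k)))) := by
        rw [hF]
        exact hq _ _
      obtain rfl : g = homOfLE (by lia : a ≤ a + k) ≫ homOfLE (Nat.le_succ (a + k)) :=
        Subsingleton.elim _ _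
      rw [F.map_comp]
      infer_instance
  obtain ⟨N, φ, hφ, hN⟩ := exists_limit_of_eventually_isIso F n hF₁ hF₂
  have hN' (i : ℤ) (hi : i < n) : IsZero (N.X i) := by
    have := hF₁ 0 _ (homOfLE (Nat.zero_le (i + 1 - n).toNat)) i (by simpa using hi)
    exact (L.isZero_of_isStrictlyGE n i hi).of_iso
      ((hN i).some ≪≫ (asIso ((F.map (homOfLE (Nat.zero_le (i + 1 - n).toNat))).f i)).symm)
  refine ⟨N, φ, hφ, (CochainComplex.isStrictlyGE_iff _ _).2 hN', fun i ↦ ?_⟩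
  by_cases hi : i < n
  · exact P.prop_of_isZero (hN' i hi)
  · obtain ⟨j, rfl⟩ := Int.le.dest (not_lt.1 hi)
    -- In degree `n + j` the limit is read off at stage `j + 1`, exactly the stage that was built to
    -- satisfy `P` in that degree.
    refine P.prop_of_iso (hN _).some.symm ?_
    rw [show (n + (j : ℤ) + 1 - n).toNat = j + 1 by lia]
    exact hP _ _

/-- Under `opEquivalence` the degree `m` part is the opposite of the degree `-m` part. This
transports right resolutions in the opposite category to left resolutions. -/
lemma quasiIso_op_iff {K L : CochainComplex A ℤ} (f : K ⟶ L) :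
    QuasiIso ((opEquivalence A).functor.map f.op) ↔ QuasiIso f := by
  have h (m : ℤ) : QuasiIsoAt ((opEquivalence A).functor.map f.op) m ↔ QuasiIsoAt f (-m) := by
    rw [quasiIsoAt_iff' _ (m - 1) m (m + 1) (by simp) (by simp),
      quasiIsoAt_iff' f (-(m + 1)) (-m) (-(m - 1)) (by simp; lia) (by simp; lia)]
    exact ShortComplex.quasiIso_opMap_iff ((HomologicalComplex.shortComplexFunctor' A
      (ComplexShape.up ℤ) (-(m + 1)) (-m) (-(m - 1))).map f)
  simp only [quasiIso_iff, h]
  exact ⟨fun H i ↦ by simpa using H (-i), fun H i ↦ H _⟩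

/-- If every object is a quotient of an object satisfying `P`, then every bounded above complex has
a bounded above left resolution with terms in `P`. -/
lemma exists_left_resolution (P : ObjectProperty A) [P.IsClosedUnderIsomorphisms]
    [P.ContainsZero] (hP : ∀ X : A, ∃ (Y : A) (p : Y ⟶ X), P Y ∧ Epi p)
    (L : CochainComplex A ℤ) (n : ℤ) [L.IsStrictlyLE n] :
    ∃ (M : CochainComplex A ℤ) (φ : M ⟶ L), QuasiIso φ ∧ M.IsStrictlyLE n ∧ ∀ i, P (M.X i) := by
  let e := opEquivalence A
  have hL : (e.functor.obj (Opposite.op L)).IsStrictlyGE (-n) :=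
    (isStrictlyGE_iff _ _).2 fun i hi ↦ (L.isZero_of_isStrictlyLE n (-i) (by lia)).op
  have : P.op.ContainsZero := by
    obtain ⟨Z, hZ, hZ'⟩ := ObjectProperty.ContainsZero.exists_zero (P := P)
    exact ⟨Opposite.op Z, hZ.op, hZ'⟩
  obtain ⟨M, φ, hφ, hM, hM'⟩ := exists_right_resolution P.op (fun X ↦ by
    obtain ⟨Y, p, hY, _⟩ := hP X.unop
    exact ⟨Opposite.op Y, p.op, hY, inferInstance⟩) (e.functor.obj (Opposite.op L)) (-n)
  let ψ : Opposite.op L ⟶ e.inverse.obj M := e.unit.app _ ≫ e.inverse.map φ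
  refine ⟨(e.inverse.obj M).unop, ψ.unop, ?_, ?_, fun i ↦ hM' (-i)⟩
  · rw [← quasiIso_op_iff]
    have h : e.functor.map ψ = φ ≫ e.counitInv.app M := by
      dsimp only [ψ]
      rw [Functor.map_comp, e.fun_inv_map, e.functor_unit_comp_assoc]
    change QuasiIso (e.functor.map ψ)
    rw [h]
    infer_instance
  · exact (isStrictlyLE_iff _ _).2 fun i hi ↦ (M.isZero_of_isStrictlyGE (-n) (-i) (by lia)).unop

end CochainComplex

/-! ### Full faithfulness between localizations -/

namespace CategoryTheory.Localization

open MorphismProperty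

variable {C₁ C₂ D₁ D₂ : Type*} [Category* C₁] [Category* C₂] [Category* D₁] [Category* D₂]
  {G : C₁ ⥤ C₂} {L₁ : C₁ ⥤ D₁} {L₂ : C₂ ⥤ D₂} {H : D₁ ⥤ D₂} (e : L₁ ⋙ H ≅ G ⋙ L₂)
  (W₁ : MorphismProperty C₁) (W₂ : MorphismProperty C₂)
  [L₁.IsLocalization W₁] [L₂.IsLocalization W₂]

include e

lemma map_map_eq_map_map_iff {X Y : C₁} (f g : X ⟶ Y) :
    H.map (L₁.map f) = H.map (L₁.map g) ↔ L₂.map (G.map f) = L₂.map (G.map g) := by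
  have h₁ := NatIso.naturality_2 e f
  have h₂ := NatIso.naturality_2 e g
  dsimp at h₁ h₂
  rw [← h₁, ← h₂, cancel_epi, cancel_mono]

/-- The functor induced by a fully faithful functor on localized categories is bijective on
morphisms to an object `Y`, if the denominators with source `Y` can be refined by denominators of
the source category. -/
lemma map_bijective_of_postcomp [G.Full] [G.Faithful] [W₁.HasRightCalculusOfFractions]
    [W₂.HasLeftCalculusOfFractions] (Y : C₁)
    (h : ∀ ⦃Z : C₂⦄ (s : G.obj Y ⟶ Z), W₂ s →
      ∃ (Y' : C₁) (t : Z ⟶ G.obj Y') (u : Y ⟶ Y'), W₁ u ∧ s ≫ t = G.map u) (X : C₁) :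
    Function.Bijective (H.map : (L₁.obj X ⟶ L₁.obj Y) → _) := by
  constructor
  · intro f g hfg
    -- Composing with the denominators `φ.s` and `ψ.s` turns both `f` and `g` into images of
    -- morphisms of `C₁`.
    obtain ⟨φ, rfl⟩ := exists_rightFraction L₁ W₁ f
    obtain ⟨ψ, hψ⟩ := exists_rightFraction L₁ W₁ (L₁.map φ.s ≫ g)
    have := Localization.inverts L₁ W₁ φ.s φ.hs
    have := Localization.inverts L₁ W₁ ψ.s ψ.hs
    have hψ' : L₁.map ψ.s ≫ L₁.map φ.s ≫ g = L₁.map ψ.f := by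
      rw [hψ, RightFraction.map_s_comp_map]
    rw [← cancel_epi (L₁.map φ.s), ← cancel_epi (L₁.map ψ.s), RightFraction.map_s_comp_map, hψ',
      ← L₁.map_comp]
    have h₂ : L₂.map (G.map (ψ.s ≫ φ.f)) = L₂.map (G.map ψ.f) := by
      rw [← map_map_eq_map_map_iff e, ← hψ', L₁.map_comp, H.map_comp, H.map_comp, H.map_comp,
        ← hfg, ← H.map_comp _ (φ.map _ _), RightFraction.map_s_comp_map]
    -- The equality in `D₂` is witnessed by a denominator `s` out of `G.obj Y`; refining it to
    -- `G.map u` lets the witness descend to `C₁`.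
    obtain ⟨Z, s, hs, fac⟩ := (map_eq_iff_postcomp L₂ W₂ _ _).1 h₂
    obtain ⟨Y', t, u, hu, fac'⟩ := h s hs
    have := Localization.inverts L₁ W₁ u hu
    rw [← cancel_mono (L₁.map u), ← L₁.map_comp, ← L₁.map_comp]
    congr 1
    apply G.map_injective
    rw [G.map_comp, G.map_comp _ u, ← fac', reassoc_of% fac]
  · intro g
    -- Multiplying numerator and denominator of this fraction by `t` makes the denominator `G.map
    -- u`; fullness of `G` then lifts the numerator.
    obtain ⟨φ, hφ⟩ := exists_leftFraction L₂ W₂ (e.inv.app X ≫ g ≫ e.hom.app Y)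
    obtain ⟨Y', t, u, hu, fac⟩ := h φ.s φ.hs
    obtain ⟨v, hv⟩ := G.map_surjective (φ.f ≫ t)
    have := Localization.inverts L₁ W₁ u hu
    have h₁ : H.map (L₁.map u) ≫ e.hom.app Y' = e.hom.app Y ≫ L₂.map (G.map u) :=
      e.hom.naturality u
    have h₂ : H.map (L₁.map v) ≫ e.hom.app Y' = e.hom.app X ≫ L₂.map (G.map v) :=
      e.hom.naturality v
    have h₃ : (e.inv.app X ≫ g ≫ e.hom.app Y) ≫ L₂.map φ.s = L₂.map φ.f := by
      rw [hφ, LeftFraction.map_comp_map_s]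
    refine ⟨L₁.map v ≫ inv (L₁.map u), ?_⟩
    rw [← cancel_mono (H.map (L₁.map u)), ← H.map_comp, assoc, IsIso.inv_hom_id, comp_id,
      ← cancel_mono (e.hom.app Y'), assoc, h₁, h₂, hv, ← fac, L₂.map_comp, L₂.map_comp, ← h₃]
    simp

/-- The functor induced by a fully faithful functor on localized categories is bijective on
morphisms from an object `X`, if the denominators with target `X` can be refined by denominators
of the source category. -/
lemma map_bijective_of_precomp [G.Full] [G.Faithful] [W₁.HasLeftCalculusOfFractions]
    [W₂.HasRightCalculusOfFractions] (X : C₁)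
    (h : ∀ ⦃Z : C₂⦄ (s : Z ⟶ G.obj X), W₂ s →
      ∃ (X' : C₁) (t : G.obj X' ⟶ Z) (u : X' ⟶ X), W₁ u ∧ t ≫ s = G.map u) (Y : C₁) :
    Function.Bijective (H.map : (L₁.obj X ⟶ L₁.obj Y) → _) := by
  constructor
  · intro f g hfg
    obtain ⟨φ, rfl⟩ := exists_leftFraction L₁ W₁ f
    obtain ⟨ψ, hψ⟩ := exists_leftFraction L₁ W₁ (g ≫ L₁.map φ.s)
    have := Localization.inverts L₁ W₁ φ.s φ.hs
    have := Localization.inverts L₁ W₁ ψ.s ψ.hs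
    have hψ' : g ≫ L₁.map φ.s ≫ L₁.map ψ.s = L₁.map ψ.f := by
      rw [← assoc, hψ, LeftFraction.map_comp_map_s]
    rw [← cancel_mono (L₁.map φ.s), ← cancel_mono (L₁.map ψ.s), LeftFraction.map_comp_map_s,
      assoc, hψ', ← L₁.map_comp]
    have h₂ : L₂.map (G.map (φ.f ≫ ψ.s)) = L₂.map (G.map ψ.f) := by
      rw [← map_map_eq_map_map_iff e, ← hψ', L₁.map_comp, H.map_comp, H.map_comp, H.map_comp,
        ← hfg, ← assoc, ← H.map_comp (φ.map _ _), LeftFraction.map_comp_map_s]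
    obtain ⟨Z, s, hs, fac⟩ := (map_eq_iff_precomp L₂ W₂ _ _).1 h₂
    obtain ⟨X', t, u, hu, fac'⟩ := h s hs
    have := Localization.inverts L₁ W₁ u hu
    rw [← cancel_epi (L₁.map u), ← L₁.map_comp, ← L₁.map_comp]
    congr 1
    apply G.map_injective
    rw [G.map_comp, G.map_comp u, ← fac', assoc, assoc, fac]
  · intro g
    obtain ⟨φ, hφ⟩ := exists_rightFraction L₂ W₂ (e.inv.app X ≫ g ≫ e.hom.app Y)
    obtain ⟨X', t, u, hu, fac⟩ := h φ.s φ.hs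
    obtain ⟨v, hv⟩ := G.map_surjective (t ≫ φ.f)
    have := Localization.inverts L₁ W₁ u hu
    have h₁ : H.map (L₁.map u) = e.hom.app X' ≫ L₂.map (G.map u) ≫ e.inv.app X :=
      (NatIso.naturality_2 e u).symm
    have h₂ : H.map (L₁.map v) = e.hom.app X' ≫ L₂.map (G.map v) ≫ e.inv.app Y :=
      (NatIso.naturality_2 e v).symm
    have h₃ : L₂.map φ.s ≫ (e.inv.app X ≫ g ≫ e.hom.app Y) = L₂.map φ.f := by
      rw [hφ, RightFraction.map_s_comp_map]
    refine ⟨inv (L₁.map u) ≫ L₁.map v, ?_⟩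
    rw [← cancel_epi (H.map (L₁.map u)), ← H.map_comp, IsIso.hom_inv_id_assoc, h₁, h₂, hv, ← fac,
      L₂.map_comp, L₂.map_comp, ← h₃]
    simp

end CategoryTheory.Localization

/-! ### The comparison functor is triangulated -/

namespace ExactDerived

variable {A : Type u} [Category.{v} A] [Abelian A] (P : ObjectProperty A) [IsExactSubcategory P]

section

variable [HasDerivedCategory.{w} A]

instance : (toDh P).CommShift ℤ := by
  dsimp only [toDh]; infer_instance

instance : (toDh P).IsTriangulated := by
  dsimp only [toDh]; infer_instance

instance : Localization.Lifting (Qh P) (acyclic P).trW (toDh P) (toDerived P) :=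
  Localization.Lifting.mk (Localization.fac _ _ _)

/-- The isomorphism that characterizes `toDerived`. -/
def toDerivedFactors : Qh P ⋙ toDerived P ≅ toDh P :=
  Localization.Lifting.iso (Qh P) (acyclic P).trW (toDh P) (toDerived P)

instance : (toDerived P).CommShift ℤ :=
  Functor.commShiftOfLocalization (Qh P) (acyclic P).trW ℤ (toDh P) (toDerived P)

instance : NatTrans.CommShift (toDerivedFactors P).hom ℤ :=
  inferInstanceAs (NatTrans.CommShift (Localization.Lifting.iso
    (Qh P) (acyclic P).trW (toDh P) (toDerived P)).hom ℤ)

/-- Every arrow of the quotient is isomorphic to one coming from the homotopy category, so that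
preservation of triangles by `toDerived P` can be tested there. -/
instance : (Qh P).mapArrow.EssSurj := Localization.essSurj_mapArrow _ (acyclic P).trW

instance : (toDerived P).IsTriangulated :=
  Functor.isTriangulated_of_precomp_iso (toDerivedFactors P)

/-- The image in the derived category of `A` of a complex over `P`. -/
def toDerivedObjQIso (K : CochainComplex P.FullSubcategory ℤ) :
    (toDerived P).obj ((Q P).obj K) ≅ DerivedCategory.Q.obj (asComplex P K) :=
  (toDerivedFactors P).app ((HomotopyCategory.quotient _ _).obj K) ≪≫
    (DerivedCategory.quotientCompQhIso A).app (asComplex P K)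

end

end ExactDerived

/-! ### Full faithfulness on half-bounded complexes -/

namespace ExactDerived

variable {A : Type u} [Category.{v} A] [Abelian A]

section

variable {P : ObjectProperty A} [IsExactSubcategory P]

/-- A quasi-isomorphism in `A` only has a cone exact in `A`, while a denominator over `P` needs
cycles in `P` as well. The hypothesis `h` bridges this gap; boundedness of the cone will supply it.
-/
lemma trW_quotient_map {K L : CochainComplex P.FullSubcategory ℤ} (f : K ⟶ L)
    (hf : QuasiIso ((P.ι.mapHomologicalComplex (ComplexShape.up ℤ)).map f))
    (h : (asComplex P (CochainComplex.mappingCone f)).Acyclic →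
      IsAcyclic (CochainComplex.mappingCone f)) :
    (acyclic P).trW ((HomotopyCategory.quotient _ _).map f) := by
  have hT := HomotopyCategory.mappingCone_triangleh_distinguished f
  refine ObjectProperty.trW.mk _ hT ⟨_, h ?_, ⟨Iso.refl _⟩⟩
  rw [← HomotopyCategory.quotient_obj_mem_subcategoryAcyclic_iff_acyclic]
  refine (ObjectProperty.trW_iff_of_distinguished _ _
    ((P.ι.mapHomotopyCategory (ComplexShape.up ℤ)).map_distinguished _ hT)).1 ?_
  rw [← HomotopyCategory.quasiIso_eq_trW_subcategoryAcyclic]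
  exact (HomotopyCategory.quotient_map_mem_quasiIso_iff _).2 hf

/-- The cycles vanish below `n`, and each next cycle object is the cokernel of the monomorphism from
the previous one into a term of `K`; an upward induction keeps them in `P`. -/
lemma isAcyclic_of_isStrictlyGE {P : ObjectProperty A} [IsCoresolving P]
    (K : CochainComplex P.FullSubcategory ℤ) (n : ℤ)
    (h : ∀ i < n, IsZero ((asComplex P K).X i)) (hK : (asComplex P K).Acyclic) :
    IsAcyclic K := by
  rw [isAcyclic_iff]
  refine ⟨hK, ?_⟩
  have h₀ (m : ℤ) (hm : m < n) : P ((asComplex P K).cycles m) :=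
    P.prop_of_isZero ((h m hm).of_mono ((asComplex P K).iCycles m))
  -- The induction starts in degree `n - 1`, the last one where the cycles vanish for trivial
  -- reasons.
  have h₁ (k : ℕ) (m : ℤ) (hm : m + 1 = n + k) : P ((asComplex P K).cycles m) := by
    induction k generalizing m with
    | zero => exact h₀ m (by lia)
    | succ k hk =>
      obtain ⟨m, rfl⟩ : ∃ l, m = l + 1 := ⟨m - 1, by lia⟩
      exact IsCoresolving.prop_X₃_of_shortExact (shortExact_cycles _ hK m) (hk m (by lia))
        (K.X _).property
  intro m
  by_cases hm : m < n
  · exact h₀ m hm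
  · exact h₁ (m + 1 - n).toNat m (by lia)

/-- Dually, the cycles in degree `m` are the kernel of the epimorphism from `K.X m` onto the next
cycles, so the induction runs downward from degree `n + 1`. -/
lemma isAcyclic_of_isStrictlyLE {P : ObjectProperty A} [IsResolving P]
    (K : CochainComplex P.FullSubcategory ℤ) (n : ℤ)
    (h : ∀ i, n < i → IsZero ((asComplex P K).X i)) (hK : (asComplex P K).Acyclic) :
    IsAcyclic K := by
  rw [isAcyclic_iff]
  refine ⟨hK, ?_⟩
  have h₀ (m : ℤ) (hm : n < m) : P ((asComplex P K).cycles m) :=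
    P.prop_of_isZero ((h m hm).of_mono ((asComplex P K).iCycles m))
  have h₁ (k : ℕ) (m : ℤ) (hm : m + k = n + 1) : P ((asComplex P K).cycles m) := by
    induction k generalizing m with
    | zero => exact h₀ m (by lia)
    | succ k hk =>
      exact IsResolving.prop_X₁_of_shortExact (shortExact_cycles _ hK m)
        (K.X _).property (hk (m + 1) (by lia))
  intro m
  by_cases hm : n < m
  · exact h₀ m hm
  · exact h₁ (n + 1 - m).toNat m (by lia)

end

lemma isStrictlyGE_asComplex_iff {P : ObjectProperty A} (K : CochainComplex P.FullSubcategory ℤ)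
    (n : ℤ) : (asComplex P K).IsStrictlyGE n ↔ K.IsStrictlyGE n :=
  CochainComplex.isStrictlyGE_mapHomologicalComplex_obj_iff ..

lemma isStrictlyLE_asComplex_iff {P : ObjectProperty A} (K : CochainComplex P.FullSubcategory ℤ)
    (n : ℤ) : (asComplex P K).IsStrictlyLE n ↔ K.IsStrictlyLE n :=
  CochainComplex.isStrictlyLE_mapHomologicalComplex_obj_iff ..

variable (P : ObjectProperty A)

section Coresolving

variable [IsCoresolving P]

/-- As `L` is bounded only in cohomology, it is first replaced by its canonical truncation, to which
the resolution applies. -/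
lemma exists_quasiIso_asComplex_of_isGE (L : CochainComplex A ℤ) (n : ℤ) [L.IsGE n] :
    ∃ (M : CochainComplex P.FullSubcategory ℤ) (f : L ⟶ asComplex P M), M.IsStrictlyGE n ∧
      QuasiIso f := by
  obtain ⟨M, φ, _, hM, hM'⟩ := CochainComplex.exists_right_resolution P
    IsCoresolving.exists_mono (L.truncGE n) n
  exact ⟨HomologicalComplex.liftObjectProperty P M hM', L.πTruncGE n ≫ φ,
    (isStrictlyGE_asComplex_iff _ n).1 hM, inferInstanceAs (QuasiIso (L.πTruncGE n ≫ φ))⟩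

variable [HasDerivedCategory.{w} A]

/-- Only denominators starting at the target have to be refined, which is why `X` may be unbounded.
-/
lemma toDerived_map_bijective_of_isStrictlyGE (X : DerivedCat P)
    (L : CochainComplex P.FullSubcategory ℤ) (n : ℤ) [L.IsStrictlyGE n] :
    Function.Bijective ((toDerived P).map : (X ⟶ (Q P).obj L) → _) := by
  obtain ⟨X, rfl⟩ := (Localization.Construction.objEquiv (acyclic P).trW).surjective X
  refine Localization.map_bijective_of_postcomp (toDerivedFactors P) (acyclic P).trW
    (HomotopyCategory.subcategoryAcyclic A).trW ((HomotopyCategory.quotient _ _).obj L) ?_ X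
  intro Z s hs
  obtain ⟨Z : CochainComplex A ℤ, rfl⟩ := HomotopyCategory.quotient_obj_surjective Z
  obtain ⟨s, rfl⟩ : ∃ s' : asComplex P L ⟶ Z, s = (HomotopyCategory.quotient _ _).map s' :=
    ⟨_, ((HomotopyCategory.quotient _ _).map_preimage s).symm⟩
  have hs : QuasiIso s := (HomotopyCategory.quotient_map_mem_quasiIso_iff s).1 (by
    rw [HomotopyCategory.quasiIso_eq_trW_subcategoryAcyclic]; exact hs)
  have hL : (asComplex P L).IsStrictlyGE n := (isStrictlyGE_asComplex_iff _ n).2 inferInstance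
  have hZ : Z.IsGE n := (CochainComplex.isGE_iff _ _).2 fun i hi ↦ by
    rw [← exactAt_iff_of_quasiIsoAt s]
    exact (asComplex P L).exactAt_of_isGE n i hi
  obtain ⟨M, t, hM, ht⟩ := exists_quasiIso_asComplex_of_isGE P Z n
  obtain ⟨u, hu⟩ := (P.ι.mapHomologicalComplex (ComplexShape.up ℤ)).map_surjective (s ≫ t)
  refine ⟨_, (HomotopyCategory.quotient _ _).map t, (HomotopyCategory.quotient _ _).map u,
    trW_quotient_map u (by rw [hu]; infer_instance)
      -- Degree `i` of the cone involves `L` in degree `i + 1`, which costs one degree in the bound.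
      (isAcyclic_of_isStrictlyGE _ (n - 1) fun i hi ↦ ?_), ?_⟩
  · refine Functor.map_isZero P.ι ((CochainComplex.mappingCone.isZero_X_iff u i).2
      ⟨L.isZero_of_isStrictlyGE n _, M.isZero_of_isStrictlyGE n _⟩)
  · exact (Functor.map_comp _ _ _).symm.trans
      (congr_arg (HomotopyCategory.quotient _ _).map hu.symm)

end Coresolving

section Resolving

variable [IsResolving P]

lemma exists_quasiIso_asComplex_of_isLE (L : CochainComplex A ℤ) (n : ℤ) [L.IsLE n] :
    ∃ (M : CochainComplex P.FullSubcategory ℤ) (f : asComplex P M ⟶ L), M.IsStrictlyLE n ∧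
      QuasiIso f := by
  obtain ⟨M, φ, _, hM, hM'⟩ := CochainComplex.exists_left_resolution P
    IsResolving.exists_epi (L.truncLE n) n
  exact ⟨HomologicalComplex.liftObjectProperty P M hM', φ ≫ L.ιTruncLE n,
    (isStrictlyLE_asComplex_iff _ n).1 hM, inferInstanceAs (QuasiIso (φ ≫ L.ιTruncLE n))⟩

variable [HasDerivedCategory.{w} A]

/-- Dual argument: left resolutions refine the denominators ending at the bounded above source. -/
lemma toDerived_map_bijective_of_isStrictlyLE (L : CochainComplex P.FullSubcategory ℤ)
    (X : DerivedCat P) (n : ℤ) [L.IsStrictlyLE n] :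
    Function.Bijective ((toDerived P).map : ((Q P).obj L ⟶ X) → _) := by
  obtain ⟨X, rfl⟩ := (Localization.Construction.objEquiv (acyclic P).trW).surjective X
  refine Localization.map_bijective_of_precomp (toDerivedFactors P) (acyclic P).trW
    (HomotopyCategory.subcategoryAcyclic A).trW ((HomotopyCategory.quotient _ _).obj L) ?_ X
  intro Z s hs
  obtain ⟨Z : CochainComplex A ℤ, rfl⟩ := HomotopyCategory.quotient_obj_surjective Z
  obtain ⟨s, rfl⟩ : ∃ s' : Z ⟶ asComplex P L, s = (HomotopyCategory.quotient _ _).map s' :=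
    ⟨_, ((HomotopyCategory.quotient _ _).map_preimage s).symm⟩
  have hs : QuasiIso s := (HomotopyCategory.quotient_map_mem_quasiIso_iff s).1 (by
    rw [HomotopyCategory.quasiIso_eq_trW_subcategoryAcyclic]; exact hs)
  have hL : (asComplex P L).IsStrictlyLE n := (isStrictlyLE_asComplex_iff _ n).2 inferInstance
  have hZ : Z.IsLE n := (CochainComplex.isLE_iff _ _).2 fun i hi ↦ by
    rw [exactAt_iff_of_quasiIsoAt s]
    exact (asComplex P L).exactAt_of_isLE n i hi
  obtain ⟨M, t, hM, ht⟩ := exists_quasiIso_asComplex_of_isLE P Z n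
  obtain ⟨u, hu⟩ := (P.ι.mapHomologicalComplex (ComplexShape.up ℤ)).map_surjective (t ≫ s)
  refine ⟨_, (HomotopyCategory.quotient _ _).map t, (HomotopyCategory.quotient _ _).map u,
    trW_quotient_map u (by rw [hu]; infer_instance)
      -- Here the shift inside the cone helps: `M` in degree `i + 1` and `L` in degree `i` both
      -- vanish for `i > n`.
      (isAcyclic_of_isStrictlyLE _ n fun i hi ↦ ?_), ?_⟩
  · refine Functor.map_isZero P.ι ((CochainComplex.mappingCone.isZero_X_iff u i).2
      ⟨M.isZero_of_isStrictlyLE n _, L.isZero_of_isStrictlyLE n _⟩)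
  · exact (Functor.map_comp _ _ _).symm.trans
      (congr_arg (HomotopyCategory.quotient _ _).map hu.symm)

end Resolving

end ExactDerived

/-! ### Lifting a t-structure along a triangulated functor -/

namespace CategoryTheory.Triangulated.TStructure

variable {C : Type*} [Category* C] [HasShift C ℤ]
  {D : Type*} [Category* D] [Preadditive D] [HasZeroObject D] [HasShift D ℤ]
  [∀ (n : ℤ), (shiftFunctor D n).Additive] [Pretriangulated D]
  (F : C ⥤ D) [F.CommShift ℤ] (t : TStructure D)

lemma isLE_map_shift_iff (X : C) (n a n' : ℤ) (h : a + n' = n) :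
    t.IsLE (F.obj (X⟦a⟧)) n' ↔ t.IsLE (F.obj X) n := by
  rw [← t.isLE_shift_iff (F.obj X) n a n' h, ← t.le_iff_isLE, ← t.le_iff_isLE]
  exact (t.le n').prop_iff_of_iso ((F.commShiftIso a).app X)

lemma isGE_map_shift_iff (X : C) (n a n' : ℤ) (h : a + n' = n) :
    t.IsGE (F.obj (X⟦a⟧)) n' ↔ t.IsGE (F.obj X) n := by
  rw [← t.isGE_shift_iff (F.obj X) n a n' h, ← t.ge_iff_isGE, ← t.ge_iff_isGE]
  exact (t.ge n').prop_iff_of_iso ((F.commShiftIso a).app X)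

variable [Preadditive C] [HasZeroObject C] [∀ (n : ℤ), (shiftFunctor C n).Additive]
  [Pretriangulated C]
  [F.IsTriangulated]

variable (le ge : ObjectProperty C) [le.IsClosedUnderIsomorphisms] [ge.IsClosedUnderIsomorphisms]

/-- The t-structure induced along a triangulated functor `F` that is fully faithful on morphisms
to the objects of a subcategory which lifts the coaisle. -/
def ofMapBijectiveToGE (hle : ∀ X, le X ↔ t.IsLE (F.obj X) 0) (hge : ge.shift (1 : ℤ) ≤ ge)
    (hF : ∀ X Y, ge.shift (1 : ℤ) Y → Function.Bijective (F.map : (X ⟶ Y) → _))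
    (hge₁ : ∀ Y, ge.shift (1 : ℤ) Y → t.IsGE (F.obj Y) 1)
    (hge₂ : ∀ V, t.IsGE V 1 → ∃ Y, ge.shift (1 : ℤ) Y ∧ Nonempty (V ≅ F.obj Y)) :
    TStructure C where
  le n := le.shift n
  ge n := ge.shift n
  le_shift n a n' h X hX := by rw [← le.shift_shift a n' n h] at hX; exact hX
  ge_shift n a n' h X hX := by rw [← ge.shift_shift a n' n h] at hX; exact hX
  zero' X Y f hX hY := by
    rw [le.shift_zero] at hX
    have := (hle X).1 hX
    have := hge₁ Y hY
    exact (hF X Y hY).1 ((t.zero (F.map f) 0 1).trans (F.map_zero _ _).symm)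
  le_zero_le X hX := by
    rw [le.shift_zero] at hX
    have := (hle X).1 hX
    refine (hle _).2 ((isLE_map_shift_iff F t X 1 1 0 rfl).2 (t.isLE_of_le _ 0 1))
  ge_one_le := by rwa [ge.shift_zero]
  exists_triangle_zero_one X := by
    obtain ⟨U, V, hU, hV, a, b, c, hT⟩ := t.exists_triangle_zero_one (F.obj X)
    obtain ⟨Y, hY, ⟨e⟩⟩ := hge₂ V ⟨hV⟩
    -- The truncation map `F.obj X ⟶ V` lifts to `g`; the triangle on `g` then maps to one
    -- isomorphic to the truncation triangle, which puts `F.obj Z` in the aisle.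
    obtain ⟨g, hg⟩ := (hF X Y hY).2 (b ≫ e.hom)
    obtain ⟨Z, f, h, hT'⟩ := distinguished_cocone_triangle₁ g
    refine ⟨Z, Y, ?_, hY, f, g, h, hT'⟩
    rw [le.shift_zero, hle]
    have e' := Triangle.π₃.mapIso (isoTriangleOfIso₁₂ _ _ (rot_of_distTriang _ hT)
      (rot_of_distTriang _ (F.map_distinguished _ hT')) (Iso.refl _) e
        (hg.symm.trans (id_comp _).symm))
    have hU : t.IsLE U 0 := ⟨hU⟩
    have : t.IsLE (Triangle.π₃.obj (Triangle.mk a b c).rotate) (-1) := t.isLE_shift U 0 1 (-1)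
    have : t.IsLE ((F.obj Z)⟦(1 : ℤ)⟧) (-1) := t.isLE_of_iso e' (-1)
    exact t.isLE_of_shift _ 0 1 (-1)

/-- The t-structure induced along a triangulated functor `F` that is fully faithful on morphisms
from the objects of a subcategory which lifts the aisle. -/
def ofMapBijectiveFromLE (hge : ∀ X, ge X ↔ t.IsGE (F.obj X) 0) (hle : le ≤ le.shift (1 : ℤ))
    (hF : ∀ X Y, le X → Function.Bijective (F.map : (X ⟶ Y) → _))
    (hle₁ : ∀ X, le X → t.IsLE (F.obj X) 0)
    (hle₂ : ∀ U, t.IsLE U 0 → ∃ X, le X ∧ Nonempty (F.obj X ≅ U)) :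
    TStructure C where
  le n := le.shift n
  ge n := ge.shift n
  le_shift n a n' h X hX := by rw [← le.shift_shift a n' n h] at hX; exact hX
  ge_shift n a n' h X hX := by rw [← ge.shift_shift a n' n h] at hX; exact hX
  zero' X Y f hX hY := by
    rw [le.shift_zero] at hX
    have := hle₁ X hX
    have := (isGE_map_shift_iff F t Y 1 1 0 rfl).1 ((hge _).1 hY)
    exact (hF X Y hX).1 ((t.zero (F.map f) 0 1).trans (F.map_zero _ _).symm)
  le_zero_le := by rwa [le.shift_zero]
  ge_one_le X hX := by
    have := (isGE_map_shift_iff F t X 1 1 0 rfl).1 ((hge _).1 hX)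
    rw [ge.shift_zero]
    exact (hge _).2 (t.isGE_of_ge _ 0 1)
  exists_triangle_zero_one Y := by
    obtain ⟨U, V, hU, hV, a, b, c, hT⟩ := t.exists_triangle_zero_one (F.obj Y)
    obtain ⟨X, hX, ⟨e⟩⟩ := hle₂ U ⟨hU⟩
    -- Dually the map from the aisle part is lifted, and the image of its cone is identified with
    -- `V`.
    obtain ⟨f, hf⟩ := (hF X Y hX).2 (e.hom ≫ a)
    obtain ⟨Z, g, h, hT'⟩ := distinguished_cocone_triangle f
    refine ⟨X, Z, by rwa [le.shift_zero], ?_, f, g, h, hT'⟩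
    have e' := Triangle.π₃.mapIso (isoTriangleOfIso₁₂ _ _ (F.map_distinguished _ hT') hT
      e (Iso.refl _) ((comp_id _).trans hf))
    have hV : t.IsGE (Triangle.π₃.obj (Triangle.mk a b c)) 1 := ⟨hV⟩
    exact (hge _).2 ((isGE_map_shift_iff F t Z 1 1 0 rfl).2 (t.isGE_of_iso e'.symm 1))

end CategoryTheory.Triangulated.TStructure

/-! ### The two t-structures -/

namespace ExactDerived

variable {A : Type u} [Category.{v} A] [Abelian A] (P : ObjectProperty A) [IsExactSubcategory P]

instance : (cohLE P).IsClosedUnderIsomorphisms where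
  of_iso := fun e ⟨K, ⟨e'⟩, hK⟩ ↦ ⟨K, ⟨e.symm ≪≫ e'⟩, hK⟩

instance : (cohGE P).IsClosedUnderIsomorphisms where
  of_iso := fun e ⟨K, ⟨e'⟩, hK⟩ ↦ ⟨K, ⟨e.symm ≪≫ e'⟩, hK⟩

instance : (strictLE P).IsClosedUnderIsomorphisms where
  of_iso := fun e ⟨K, ⟨e'⟩, hK⟩ ↦ ⟨K, ⟨e.symm ≪≫ e'⟩, hK⟩

instance : (strictGE P).IsClosedUnderIsomorphisms where
  of_iso := fun e ⟨K, ⟨e'⟩, hK⟩ ↦ ⟨K, ⟨e.symm ≪≫ e'⟩, hK⟩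

lemma exists_iso_Q_obj (X : DerivedCat P) :
    ∃ K : CochainComplex P.FullSubcategory ℤ, Nonempty (X ≅ (Q P).obj K) := by
  obtain ⟨X, rfl⟩ := (Localization.Construction.objEquiv (acyclic P).trW).surjective X
  obtain ⟨K, rfl⟩ := HomotopyCategory.quotient_obj_surjective X
  exact ⟨K, ⟨Iso.refl _⟩⟩

lemma strictGE_shift_iff (n : ℤ) (X : DerivedCat P) : (strictGE P).shift n X ↔
    ∃ K : CochainComplex P.FullSubcategory ℤ, Nonempty (X ≅ (Q P).obj K) ∧ K.IsStrictlyGE n := by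
  constructor
  · rintro ⟨K, ⟨e⟩, hK⟩
    have : K.IsStrictlyGE 0 := (CochainComplex.isStrictlyGE_iff _ _).2 hK
    exact ⟨K⟦-n⟧, ⟨(shiftShiftNeg X n).symm ≪≫ (shiftFunctor _ (-n)).mapIso e ≪≫
      ((Q P).commShiftIso (-n)).symm.app K⟩, K.isStrictlyGE_shift 0 (-n) n (by lia)⟩
  · rintro ⟨K, ⟨e⟩, hK⟩
    exact ⟨K⟦n⟧, ⟨(shiftFunctor _ n).mapIso e ≪≫ ((Q P).commShiftIso n).symm.app K⟩,
      fun i hi ↦ by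
        have := K.isStrictlyGE_shift n n 0 (by lia)
        exact (K⟦n⟧).isZero_of_isStrictlyGE 0 i hi⟩

lemma strictLE_shift_iff (n : ℤ) (X : DerivedCat P) : (strictLE P).shift n X ↔
    ∃ K : CochainComplex P.FullSubcategory ℤ, Nonempty (X ≅ (Q P).obj K) ∧ K.IsStrictlyLE n := by
  constructor
  · rintro ⟨K, ⟨e⟩, hK⟩
    have : K.IsStrictlyLE 0 := (CochainComplex.isStrictlyLE_iff _ _).2 hK
    exact ⟨K⟦-n⟧, ⟨(shiftShiftNeg X n).symm ≪≫ (shiftFunctor _ (-n)).mapIso e ≪≫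
      ((Q P).commShiftIso (-n)).symm.app K⟩, K.isStrictlyLE_shift 0 (-n) n (by lia)⟩
  · rintro ⟨K, ⟨e⟩, hK⟩
    exact ⟨K⟦n⟧, ⟨(shiftFunctor _ n).mapIso e ≪≫ ((Q P).commShiftIso n).symm.app K⟩,
      fun i hi ↦ by
        have := K.isStrictlyLE_shift n n 0 (by lia)
        exact (K⟦n⟧).isZero_of_isStrictlyLE 0 i hi⟩

section

variable [HasDerivedCategory.{w} A]

/-- Cohomology over `A` is visible in the derived category of `A`, so the condition does not depend
on the chosen representing complex. -/
lemma cohLE_iff (X : DerivedCat P) : cohLE P X ↔ ((toDerived P).obj X).IsLE 0 := by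
  have h (K : CochainComplex P.FullSubcategory ℤ) :
      ((toDerived P).obj ((Q P).obj K)).IsLE 0 ↔
        ∀ n : ℤ, 0 < n → IsZero ((asComplex P K).homology n) := by
    simp only [← HomologicalComplex.exactAt_iff_isZero_homology]
    rw [← CochainComplex.isLE_iff, ← DerivedCategory.isLE_Q_obj_iff]
    exact ⟨fun _ ↦ DerivedCategory.TStructure.t.isLE_of_iso (toDerivedObjQIso P K) 0,
      fun _ ↦ DerivedCategory.TStructure.t.isLE_of_iso (toDerivedObjQIso P K).symm 0⟩
  constructor
  · rintro ⟨K, ⟨e⟩, hK⟩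
    have := (h K).2 hK
    exact DerivedCategory.TStructure.t.isLE_of_iso ((toDerived P).mapIso e.symm) 0
  · intro hX
    obtain ⟨K, ⟨e⟩⟩ := exists_iso_Q_obj P X
    exact ⟨K, ⟨e⟩, (h K).1 (DerivedCategory.TStructure.t.isLE_of_iso ((toDerived P).mapIso e) 0)⟩

lemma cohGE_iff (X : DerivedCat P) : cohGE P X ↔ ((toDerived P).obj X).IsGE 0 := by
  have h (K : CochainComplex P.FullSubcategory ℤ) :
      ((toDerived P).obj ((Q P).obj K)).IsGE 0 ↔
        ∀ n : ℤ, n < 0 → IsZero ((asComplex P K).homology n) := by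
    simp only [← HomologicalComplex.exactAt_iff_isZero_homology]
    rw [← CochainComplex.isGE_iff, ← DerivedCategory.isGE_Q_obj_iff]
    exact ⟨fun _ ↦ DerivedCategory.TStructure.t.isGE_of_iso (toDerivedObjQIso P K) 0,
      fun _ ↦ DerivedCategory.TStructure.t.isGE_of_iso (toDerivedObjQIso P K).symm 0⟩
  constructor
  · rintro ⟨K, ⟨e⟩, hK⟩
    have := (h K).2 hK
    exact DerivedCategory.TStructure.t.isGE_of_iso ((toDerived P).mapIso e.symm) 0
  · intro hX
    obtain ⟨K, ⟨e⟩⟩ := exists_iso_Q_obj P X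
    exact ⟨K, ⟨e⟩, (h K).1 (DerivedCategory.TStructure.t.isGE_of_iso ((toDerived P).mapIso e) 0)⟩

lemma isGE_toDerived_obj_of_strictGE_shift (n : ℤ) (X : DerivedCat P)
    (hX : (strictGE P).shift n X) : ((toDerived P).obj X).IsGE n := by
  obtain ⟨K, ⟨e⟩, hK⟩ := (strictGE_shift_iff P n X).1 hX
  have : (asComplex P K).IsStrictlyGE n := (isStrictlyGE_asComplex_iff K n).2 hK
  exact DerivedCategory.TStructure.t.isGE_of_iso
    ((toDerived P).mapIso e ≪≫ toDerivedObjQIso P K).symm n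

lemma isLE_toDerived_obj_of_strictLE_shift (n : ℤ) (X : DerivedCat P)
    (hX : (strictLE P).shift n X) : ((toDerived P).obj X).IsLE n := by
  obtain ⟨K, ⟨e⟩, hK⟩ := (strictLE_shift_iff P n X).1 hX
  have : (asComplex P K).IsStrictlyLE n := (isStrictlyLE_asComplex_iff K n).2 hK
  exact DerivedCategory.TStructure.t.isLE_of_iso
    ((toDerived P).mapIso e ≪≫ toDerivedObjQIso P K).symm n

end

lemma bijective_map_of_iso {C D : Type*} [Category* C] [Category* D] (F : C ⥤ D) {X X' Y Y' : C}
    (e : X ≅ X') (e' : Y ≅ Y') (h : Function.Bijective (F.map : (X' ⟶ Y') → _)) :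
    Function.Bijective (F.map : (X ⟶ Y) → _) := by
  have : (F.map : (X ⟶ Y) → _) =
      ((F.mapIso e).homCongr (F.mapIso e')).symm ∘ F.map ∘ e.homCongr e' := by
    ext f; simp
  rw [this]
  exact (Equiv.bijective _).comp (h.comp (Equiv.bijective _))

section

variable [HasDerivedCategory.{w} A]

lemma toDerived_map_bijective_of_strictGE_shift {P : ObjectProperty A} [IsCoresolving P] (n : ℤ)
    (X Y : DerivedCat P) (hY : (strictGE P).shift n Y) :
    Function.Bijective ((toDerived P).map : (X ⟶ Y) → _) := by
  obtain ⟨K, ⟨e⟩, hK⟩ := (strictGE_shift_iff P n Y).1 hY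
  exact bijective_map_of_iso _ (Iso.refl _) e (toDerived_map_bijective_of_isStrictlyGE P X K n)

lemma toDerived_map_bijective_of_strictLE_shift {P : ObjectProperty A} [IsResolving P] (n : ℤ)
    (X Y : DerivedCat P) (hX : (strictLE P).shift n X) :
    Function.Bijective ((toDerived P).map : (X ⟶ Y) → _) := by
  obtain ⟨K, ⟨e⟩, hK⟩ := (strictLE_shift_iff P n X).1 hX
  exact bijective_map_of_iso _ e (Iso.refl _) (toDerived_map_bijective_of_isStrictlyLE P K Y n)

lemma exists_strictGE_shift_iso {P : ObjectProperty A} [IsCoresolving P] (n : ℤ)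
    (V : DerivedCategory A) (hV : V.IsGE n) :
    ∃ Y, (strictGE P).shift n Y ∧ Nonempty (V ≅ (toDerived P).obj Y) := by
  obtain ⟨L, hL, ⟨e⟩⟩ := V.exists_iso_Q_obj_of_isGE n
  obtain ⟨M, f, hM, hf⟩ := exists_quasiIso_asComplex_of_isGE P L n
  exact ⟨(Q P).obj M, (strictGE_shift_iff P n _).2 ⟨M, ⟨Iso.refl _⟩, hM⟩,
    ⟨e ≪≫ asIso (DerivedCategory.Q.map f) ≪≫ (toDerivedObjQIso P M).symm⟩⟩

lemma exists_strictLE_shift_iso {P : ObjectProperty A} [IsResolving P] (n : ℤ)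
    (V : DerivedCategory A) (hV : V.IsLE n) :
    ∃ Y, (strictLE P).shift n Y ∧ Nonempty (V ≅ (toDerived P).obj Y) := by
  obtain ⟨L, hL, ⟨e⟩⟩ := V.exists_iso_Q_obj_of_isLE n
  obtain ⟨M, f, hM, hf⟩ := exists_quasiIso_asComplex_of_isLE P L n
  exact ⟨(Q P).obj M, (strictLE_shift_iff P n _).2 ⟨M, ⟨Iso.refl _⟩, hM⟩,
    ⟨e ≪≫ (asIso (DerivedCategory.Q.map f)).symm ≪≫ (toDerivedObjQIso P M).symm⟩⟩

end

variable [HasDerivedCategory.{w} A]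

/-- The t-structure on the derived category of a coresolving subcategory. -/
def tCoresolving (P : ObjectProperty A) [IsCoresolving P] :
    TStructure (DerivedCat P) :=
  TStructure.ofMapBijectiveToGE (toDerived P) DerivedCategory.TStructure.t (cohLE P) (strictGE P)
    (cohLE_iff P)
    (fun X hX ↦ by
      obtain ⟨K, e, hK⟩ := (strictGE_shift_iff P 1 X).1 hX
      exact ⟨K, e, fun n hn ↦ K.isZero_of_isStrictlyGE 1 n⟩)
    (fun X Y hY ↦ toDerived_map_bijective_of_strictGE_shift 1 X Y hY)
    (isGE_toDerived_obj_of_strictGE_shift P 1) (exists_strictGE_shift_iso 1)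

/-- The t-structure on the derived category of a resolving subcategory. -/
def tResolving (P : ObjectProperty A) [IsResolving P] :
    TStructure (DerivedCat P) :=
  TStructure.ofMapBijectiveFromLE (toDerived P) DerivedCategory.TStructure.t (strictLE P) (cohGE P)
    (cohGE_iff P)
    (fun X ⟨K, e, hK⟩ ↦ (strictLE_shift_iff P 1 X).2
      ⟨K, e, (CochainComplex.isStrictlyLE_iff _ _).2 fun n hn ↦ hK n (by lia)⟩)
    (fun X Y hX ↦ toDerived_map_bijective_of_strictLE_shift 0 X Y
      (by rwa [ObjectProperty.shift_zero]))
    (fun X hX ↦ isLE_toDerived_obj_of_strictLE_shift P 0 X (by rwa [ObjectProperty.shift_zero]))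
    (fun U hU ↦ by
      obtain ⟨X, hX, ⟨e⟩⟩ := exists_strictLE_shift_iso (P := P) 0 U hU
      rw [ObjectProperty.shift_zero] at hX
      exact ⟨X, hX, ⟨e.symm⟩⟩)

end ExactDerived

/-! ### Ext groups under an equivalence of abelian categories -/

namespace CategoryTheory

section

variable {C D : Type*} [Category* C] [Category* D] [Abelian C] [Abelian D]
  (F : C ⥤ D) [F.IsEquivalence]

section

variable [F.PreservesZeroMorphisms]

instance : (F.mapHomologicalComplex (ComplexShape.up ℤ)).IsEquivalence := by
  have : F.asEquivalence.functor.PreservesZeroMorphisms := inferInstanceAs F.PreservesZeroMorphisms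
  exact (Equivalence.mapHomologicalComplex F.asEquivalence _).isEquivalence_functor

end

variable [F.Additive] [PreservesFiniteLimits F] [PreservesFiniteColimits F]

/-- An exact equivalence is an equivalence on complexes and both preserves and detects
quasi-isomorphisms. -/
instance : (F.mapHomologicalComplexUpToQuasiIsoLocalizerMorphism
    (ComplexShape.up ℤ)).IsLocalizedEquivalence := by
  have : (F.mapHomologicalComplexUpToQuasiIsoLocalizerMorphism
    (ComplexShape.up ℤ)).functor.IsEquivalence :=
      inferInstanceAs (F.mapHomologicalComplex (ComplexShape.up ℤ)).IsEquivalence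
  have : (F.mapHomologicalComplexUpToQuasiIsoLocalizerMorphism
    (ComplexShape.up ℤ)).IsInduced := ⟨by
      ext K L f
      exact HomologicalComplex.quasiIso_map_iff_of_preservesHomology f F⟩
  exact LocalizerMorphism.isLocalizedEquivalence_of_isInduced _

instance [HasDerivedCategory C] [HasDerivedCategory D] : F.mapDerivedCategory.IsEquivalence := by
  let Φ := F.mapHomologicalComplexUpToQuasiIsoLocalizerMorphism (ComplexShape.up ℤ)
  have : CatCommSq Φ.functor (DerivedCategory.Q (C := C)) (DerivedCategory.Q (C := D))
    F.mapDerivedCategory := ⟨F.mapDerivedCategoryFactors.symm⟩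
  exact Φ.isEquivalence DerivedCategory.Q DerivedCategory.Q F.mapDerivedCategory

lemma ShiftedHom.map_bijective {C D : Type*} [Category* C] [Category* D] {M : Type*} [AddMonoid M]
    [HasShift C M] [HasShift D M] (F : C ⥤ D) [F.CommShift M] {X Y : C} {a : M}
    (h : Function.Bijective (F.map : (X ⟶ Y⟦a⟧) → _)) :
    Function.Bijective (fun f : ShiftedHom X Y a ↦ f.map F) :=
  (((F.commShiftIso a).app Y).homToEquiv.bijective).comp h

/-- Ext groups are Hom groups in derived categories, and `F` induces an equivalence of these. -/
lemma Abelian.Ext.mapExactFunctor_bijective [HasExt.{w} C] [HasExt.{v} D] (X Y : C) (n : ℕ) :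
    Function.Bijective (Ext.mapExactFunctor F : Ext.{w} X Y n → Ext.{v} _ _ n) := by
  let := HasDerivedCategory.standard C
  let := HasDerivedCategory.standard D
  have h : Function.Bijective fun x : Ext.{w} X Y n ↦ (x.mapExactFunctor F : Ext.{v} _ _ n).hom := by
    simp_rw [Ext.mapExactFunctor_hom]
    exact (Equiv.bijective (((F.mapDerivedCategorySingleFunctor 0).app X).homCongr
      ((shiftFunctor _ (n : ℤ)).mapIso ((F.mapDerivedCategorySingleFunctor 0).app Y)))).comp
      ((ShiftedHom.map_bijective F.mapDerivedCategory
        ⟨F.mapDerivedCategory.map_injective, F.mapDerivedCategory.map_surjective⟩).comp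
        Ext.homEquiv.bijective)
  exact (Ext.homEquiv.comp_bijective _).1 h

end

end CategoryTheory

/-! ### Hearts and the comparison of Ext groups -/

namespace HeartComparison

variable {C : Type u} [Category.{v} C] [Preadditive C] [HasZeroObject C] [HasShift C ℤ]
  [∀ (n : ℤ), (shiftFunctor C n).Additive] [Pretriangulated C] (t : TStructure C)

/-- Bounded objects, unlike the heart, are stable under shift and contain the cones of morphisms of
the heart; full faithfulness is therefore assumed on them. -/
lemma bounded_of_heart {X : C} (hX : t.heart X) : t.bounded X := by
  rw [t.mem_heart_iff] at hX
  exact ⟨⟨0, hX.2⟩, ⟨0, hX.1⟩⟩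

/-- The cone of a morphism of the heart lives in degrees `-1` and `0`. -/
lemma bounded_of_distTriang (T : Triangle C) (hT : T ∈ distTriang C) (h₁ : t.heart T.obj₁)
    (h₂ : t.heart T.obj₂) : t.bounded T.obj₃ := by
  rw [t.mem_heart_iff] at h₁ h₂
  have := h₁.1
  have := h₁.2
  have := h₂.1
  have := h₂.2
  have h₃ := t.isLE_shift T.obj₁ 0 1 (-1)
  have h₄ := t.isGE_shift T.obj₁ 0 1 (-1)
  exact ⟨⟨-1, t.isGE₂ _ (rot_of_distTriang _ hT) (-1) (t.isGE_of_ge T.obj₂ (-1) 0) h₄⟩,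
    ⟨0, t.isLE₂ _ (rot_of_distTriang _ hT) 0 ‹_› (t.isLE_of_le (T.obj₁⟦(1 : ℤ)⟧) (-1) 0)⟩⟩

section

variable {D : Type*} [Category* D] [Preadditive D] [HasZeroObject D] [HasShift D ℤ]
  [∀ (n : ℤ), (shiftFunctor D n).Additive] [Pretriangulated D]
  (F : C ⥤ D) [F.CommShift ℤ] [F.IsTriangulated]

/-- The map on graded morphisms induced by a triangulated functor. -/
def mapShiftedHom (X Y : C) (i : ℤ) :
    ShiftedHom X Y i →+ ShiftedHom (F.obj X) (F.obj Y) i where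
  toFun f := f.map F
  map_zero' := by simp
  map_add' := by simp

/-- A triangulated functor that is fully faithful on a suitable class of objects reflects
distinguished triangles. -/
lemma distinguished_of_map_distinguished (P : ObjectProperty C) [P.IsStableUnderShift ℤ]
    (hF : ∀ X Y, P X → P Y → Function.Bijective (F.map : (X ⟶ Y) → _)) (T : Triangle C)
    (h₁ : P T.obj₁) (h₂ : P T.obj₂) (h₃ : P T.obj₃)
    (h : ∀ ⦃Z⦄ (g : T.obj₂ ⟶ Z) (h : Z ⟶ T.obj₁⟦(1 : ℤ)⟧),
      Triangle.mk T.mor₁ g h ∈ distTriang C → P Z)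
    (hT : F.mapTriangle.obj T ∈ distTriang D) : T ∈ distTriang C := by
  obtain ⟨Z, g, h', hT'⟩ := distinguished_cocone_triangle T.mor₁
  have hZ := h g h' hT'
  -- The image of `T` and the image of a genuine triangle on the same first morphism are isomorphic;
  -- full faithfulness lifts the isomorphism of third vertices.
  let φ := isoTriangleOfIso₁₂ _ _ (F.map_distinguished _ hT') hT (Iso.refl _) (Iso.refl _)
    ((comp_id _).trans (id_comp _).symm)
  obtain ⟨a, ha⟩ := (hF Z T.obj₃ hZ h₃).2 φ.hom.hom₃
  obtain ⟨b, hb⟩ := (hF T.obj₃ Z h₃ hZ).2 φ.inv.hom₃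
  let ε : Z ≅ T.obj₃ :=
    { hom := a
      inv := b
      hom_inv_id := (hF _ _ hZ hZ).1 (by
        rw [F.map_comp, F.map_id, ha, hb]; exact φ.hom_inv_id_triangle_hom₃)
      inv_hom_id := (hF _ _ h₃ h₃).1 (by
        rw [F.map_comp, F.map_id, ha, hb]; exact φ.inv_hom_id_triangle_hom₃) }
  have c₂ : F.map g ≫ F.map a = 𝟙 _ ≫ F.map T.mor₂ := by rw [ha]; exact φ.hom.comm₂
  -- The third morphism of an image triangle carries the isomorphism commuting `F` with the shift,
  -- which is cancelled before `F` is removed.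
  have c₃ : F.map h' ≫ (F.commShiftIso (1 : ℤ)).hom.app T.obj₁ =
      F.map a ≫ F.map T.mor₃ ≫ (F.commShiftIso (1 : ℤ)).hom.app T.obj₁ := by
    rw [ha]
    exact (comp_id _).symm.trans ((congr_arg _
      (CategoryTheory.Functor.map_id (shiftFunctor D (1 : ℤ)) _).symm).trans φ.hom.comm₃)
  rw [← assoc, cancel_mono, ← F.map_comp] at c₃
  rw [id_comp, ← F.map_comp] at c₂
  refine isomorphic_distinguished _ hT' _
    (Triangle.isoMk (Triangle.mk T.mor₁ g h') T (Iso.refl _) (Iso.refl _) ε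
    ((comp_id _).trans (id_comp _).symm) (((hF _ _ h₂ h₃).1 c₂).trans (id_comp _).symm) ?_).symm
  have c₃' := (hF _ _ hZ (P.le_shift 1 _ h₁)).1 c₃
  exact ((congr_arg _ (CategoryTheory.Functor.map_id _ _)).trans (comp_id _)).trans c₃'

end

variable {A : Type*} [Category* A] [Abelian A] [HasDerivedCategory.{w} A]
  (F : C ⥤ DerivedCategory A)

/-- If `F` is fully faithful on the heart of `t` and restricts to an essentially surjective
functor to the heart of the derived category of `A`, then it identifies the heart with `A`. -/
lemma exists_heart_equivalence
    (hF : ∀ X Y, t.bounded X → t.bounded Y → Function.Bijective (F.map : (X ⟶ Y) → _))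
    (h₁ : ∀ X, t.heart X → (F.obj X).IsLE 0 ∧ (F.obj X).IsGE 0)
    (h₂ : ∀ a : A, ∃ X, t.heart X ∧ Nonempty (F.obj X ≅ (DerivedCategory.singleFunctor A 0).obj a)) :
    ∃ e : t.heart.FullSubcategory ≌ A,
      Nonempty (e.functor ⋙ DerivedCategory.singleFunctor A 0 ≅ t.heart.ι ⋙ F) := by
  have hF' (X Y : t.heart.FullSubcategory) :
      Function.Bijective ((t.heart.ι ⋙ F).map : (X ⟶ Y) → _) :=
    (hF X.obj Y.obj (bounded_of_heart t X.property) (bounded_of_heart t Y.property)).comp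
      t.heart.fullyFaithfulι.homEquiv.bijective
  have : (t.heart.ι ⋙ F).Full := ⟨fun {X Y} ↦ (hF' X Y).2⟩
  have : (t.heart.ι ⋙ F).Faithful := ⟨fun {X Y} _ _ h ↦ (hF' X Y).1 h⟩
  have hG (X : t.heart.FullSubcategory) :
      (DerivedCategory.singleFunctor A 0).essImage ((t.heart.ι ⋙ F).obj X) := by
    have ⟨_, _⟩ := h₁ X.obj X.property
    obtain ⟨Y, ⟨e⟩⟩ := DerivedCategory.exists_iso_singleFunctor_obj_of_isGE_of_isLE (F.obj X.obj) 0
    exact ⟨Y, ⟨e.symm⟩⟩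
  let G := Functor.essImage.liftFunctor (t.heart.ι ⋙ F) (DerivedCategory.singleFunctor A 0) hG
  let α : G ⋙ DerivedCategory.singleFunctor A 0 ≅ t.heart.ι ⋙ F :=
    Functor.essImage.liftFunctorCompIso _ _ hG
  have : G.Full := Functor.Full.of_comp_faithful_iso α
  have : G.Faithful := Functor.Faithful.of_comp_iso α
  have : G.EssSurj := ⟨fun a ↦ by
    obtain ⟨X, hX, ⟨e⟩⟩ := h₂ a
    exact ⟨⟨X, hX⟩, ⟨(DerivedCategory.singleFunctor A 0).preimageIso (α.app ⟨X, hX⟩ ≪≫ e)⟩⟩⟩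
  have : G.IsEquivalence := {}
  exact ⟨G.asEquivalence, ⟨α⟩⟩

section

variable {F} [IsTriangulated C] (e : t.heart.FullSubcategory ≌ A)
  (α : e.functor ⋙ DerivedCategory.singleFunctor A 0 ≅ t.heart.ι ⋙ F)

instance : e.functor.Additive :=
  have : e.functor.PreservesZeroMorphisms := inferInstance
  Functor.additive_of_preserves_binary_products _

attribute [local instance] HasExt.standard

variable {t e} in
/-- The Ext groups of the heart, compared to the morphisms in the derived category of `A`. -/
def extToShiftedHom [HasExt.{max u v} t.heart.FullSubcategory] (X Y : t.heart.FullSubcategory)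
    (i : ℕ) : Abelian.Ext.{max u v} X Y i →+ ShiftedHom (F.obj X.obj) (F.obj Y.obj) (i : ℤ) where
  toFun x := α.inv.app X ≫ (x.mapExactFunctor e.functor).hom ≫ (α.hom.app Y)⟦(i : ℤ)⟧'
  map_zero' := by simp
  map_add' := by simp

lemma extToShiftedHom_bijective [HasExt.{max u v} t.heart.FullSubcategory]
    (X Y : t.heart.FullSubcategory) (i : ℕ) :
    Function.Bijective (extToShiftedHom α X Y i) :=
  (Equiv.bijective ((α.app X).homCongr ((shiftFunctor _ (i : ℤ)).mapIso (α.app Y)))).comp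
    ((Abelian.Ext.homEquiv.bijective).comp (Abelian.Ext.mapExactFunctor_bijective e.functor X Y i))

variable {t e}

lemma extToShiftedHom_mk₀ [HasExt.{max u v} t.heart.FullSubcategory]
    {X Y : t.heart.FullSubcategory} (f : X ⟶ Y) :
    extToShiftedHom α X Y 0 (Abelian.Ext.mk₀ f) =
      ShiftedHom.mk₀ ((0 : ℕ) : ℤ) Nat.cast_zero (F.map f.hom) := by
  have h : α.inv.app X ≫ (DerivedCategory.singleFunctor A 0).map (e.functor.map f) ≫
      α.hom.app Y = F.map f.hom := NatIso.naturality_1 α f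
  change α.inv.app X ≫ ((Abelian.Ext.mk₀ f).mapExactFunctor e.functor).hom ≫ _ = _
  rw [Abelian.Ext.mapExactFunctor_mk₀, Abelian.Ext.mk₀_hom, ← h, ShiftedHom.mk₀, ShiftedHom.mk₀]
  simp only [assoc]
  exact congr_arg _ (congr_arg _
    ((shiftFunctorZero' (DerivedCategory A) ((0 : ℕ) : ℤ) Nat.cast_zero).inv.naturality
      (α.hom.app Y)).symm)

/-- The conjugating isomorphisms `α.hom` and `α.inv` at the middle object cancel. -/
lemma extToShiftedHom_comp [HasExt.{max u v} t.heart.FullSubcategory]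
    {X Y Z : t.heart.FullSubcategory} {a b c : ℕ} (h : a + b = c)
    (x : Abelian.Ext.{max u v} X Y a) (y : Abelian.Ext.{max u v} Y Z b) :
    extToShiftedHom α X Z c (x.comp y h) =
      (extToShiftedHom α X Y a x).comp (extToShiftedHom α Y Z b y) (by lia) := by
  change α.inv.app X ≫ ((x.comp y h).mapExactFunctor e.functor).hom ≫ _ =
    ShiftedHom.comp (α.inv.app X ≫ (x.mapExactFunctor e.functor).hom ≫ (α.hom.app Y)⟦(a : ℤ)⟧')
      (α.inv.app Y ≫ (y.mapExactFunctor e.functor).hom ≫ (α.hom.app Z)⟦(b : ℤ)⟧') _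
  rw [Abelian.Ext.mapExactFunctor_comp, Abelian.Ext.comp_hom, ShiftedHom.comp, ShiftedHom.comp]
  simp only [assoc, Functor.map_comp]
  rw [← Functor.map_comp_assoc _ (α.hom.app Y), Iso.hom_inv_id_app, CategoryTheory.Functor.map_id,
    id_comp]
  erw [← (shiftFunctorAdd' (DerivedCategory A) (b : ℤ) a c (by lia)).inv.naturality]
  rfl

/-- Conjugation by `α` identifies this triangle with the one attached to the image short exact
sequence in `A`. -/
lemma triangle_extToShiftedHom_extClass_distinguished [HasExt.{max u v} t.heart.FullSubcategory]
    {S : ShortComplex t.heart.FullSubcategory} (hS : S.ShortExact) :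
    Triangle.mk (F.map S.f.hom) (F.map S.g.hom)
      (extToShiftedHom α S.X₃ S.X₁ 1 hS.extClass : F.obj S.X₃.obj ⟶ (F.obj S.X₁.obj)⟦(1 : ℤ)⟧) ∈
        distTriang (DerivedCategory A) := by
  have h₃ : extToShiftedHom α S.X₃ S.X₁ 1 hS.extClass =
      α.inv.app S.X₃ ≫ (hS.map_of_exact e.functor).singleδ ≫ (α.hom.app S.X₁)⟦(1 : ℤ)⟧' := by
    have h : (hS.extClass.mapExactFunctor e.functor).hom = (hS.map_of_exact e.functor).singleδ :=
      (congr_arg Abelian.Ext.hom (Abelian.Ext.mapExactFunctor_extClass e.functor hS)).trans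
        (ShortComplex.ShortExact.extClass_hom _)
    exact congr_arg (fun x ↦ α.inv.app S.X₃ ≫ x ≫ (α.hom.app S.X₁)⟦(1 : ℤ)⟧') h
  have aux {U V W Z : DerivedCategory A} (a : U ⟶ V) (d : V ⟶ W⟦(1 : ℤ)⟧) (b : W ⟶ Z) (c : Z ⟶ W)
      (h : b ≫ c = 𝟙 _) : (a ≫ d ≫ b⟦1⟧') ≫ c⟦1⟧' = a ≫ d := by
    rw [assoc, assoc, ← Functor.map_comp, h, CategoryTheory.Functor.map_id, comp_id]
  refine isomorphic_distinguished _ (hS.map_of_exact e.functor).singleTriangle_distinguished _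
    (Triangle.isoMk _ _ (α.symm.app S.X₁) (α.symm.app S.X₂) (α.symm.app S.X₃)
      (α.inv.naturality S.f) (α.inv.naturality S.g) ?_)
  change extToShiftedHom α S.X₃ S.X₁ 1 hS.extClass ≫ (α.inv.app S.X₁)⟦(1 : ℤ)⟧' =
    α.inv.app S.X₃ ≫ (hS.map_of_exact e.functor).singleδ
  rw [h₃]
  exact aux _ _ _ _ (Iso.hom_inv_id_app α S.X₁)

end

/-- The map θ is the lift through `F` of `extToShiftedHom`. Injectivity of `F` on shifted morphisms
reduces the identities to their counterparts in the derived category of `A`, and reflection of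
distinguished triangles handles extension classes. -/
lemma isOfDerivedType_of_heart_equivalence [IsTriangulated C] [F.CommShift ℤ] [F.IsTriangulated]
    (hF : ∀ X Y, t.bounded X → t.bounded Y → Function.Bijective (F.map : (X ⟶ Y) → _))
    (e : t.heart.FullSubcategory ≌ A)
    (α : e.functor ⋙ DerivedCategory.singleFunctor A 0 ≅ t.heart.ι ⋙ F) :
    IsOfDerivedType t := by
  let : HasExt.{max u v} t.heart.FullSubcategory := HasExt.standard _
  have hF' (X Y : t.heart.FullSubcategory) (i : ℕ) :
      Function.Bijective (mapShiftedHom F X.obj Y.obj i) :=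
    ShiftedHom.map_bijective F (hF _ _ (bounded_of_heart t X.property)
      (t.bounded.le_shift (i : ℤ) _ (bounded_of_heart t Y.property)))
  let m (X Y : t.heart.FullSubcategory) (i : ℕ) := AddEquiv.ofBijective _ (hF' X Y i)
  let θ (X Y : t.heart.FullSubcategory) (i : ℕ) :
      Abelian.Ext.{max u v} X Y i →+ ShiftedHom X.obj Y.obj (i : ℤ) :=
    (m X Y i).symm.toAddMonoidHom.comp (extToShiftedHom α X Y i)
  have hθ {X Y : t.heart.FullSubcategory} {i : ℕ} (x : Abelian.Ext.{max u v} X Y i) :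
      (θ X Y i x).map F = extToShiftedHom α X Y i x := (m X Y i).apply_symm_apply _
  refine ⟨{ θ {X Y} i := θ X Y i, θ_mk₀ := ?_, θ_comp := ?_, θ_extClass := ?_ }, fun X Y i ↦
    (m X Y i).symm.bijective.comp (extToShiftedHom_bijective t e α X Y i)⟩
  · intro X Y f
    refine (hF' X Y 0).1 ?_
    change ShiftedHom.map _ F = ShiftedHom.map _ F
    rw [hθ, extToShiftedHom_mk₀, ShiftedHom.map_mk₀]
  · intro X Y Z a b c h x y
    refine (hF' X Z c).1 ?_
    change ShiftedHom.map _ F = ShiftedHom.map _ F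
    rw [hθ, extToShiftedHom_comp, ShiftedHom.map_comp, hθ, hθ]
  · intro S hS
    refine distinguished_of_map_distinguished F t.bounded hF _ (bounded_of_heart t S.X₁.property)
      (bounded_of_heart t S.X₂.property) (bounded_of_heart t S.X₃.property)
      (fun Z g h hT ↦ bounded_of_distTriang t _ hT S.X₁.property S.X₂.property) ?_
    have h := triangle_extToShiftedHom_extClass_distinguished α hS
    rw [← hθ] at h
    exact h

end HeartComparison

/-! ### Hearts of the two t-structures -/

namespace ExactDerived

variable (A : Type u) [Category.{v} A] [Abelian A] [HasDerivedCategory.{w} A]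

lemma isOfDerivedType_tCoresolving (P : ObjectProperty A) [IsCoresolving P] :
    HeartComparison.IsOfDerivedType (tCoresolving P) ∧
      ∃ e : (tCoresolving P).heart.FullSubcategory ≌ A,
        Nonempty (e.functor ⋙ DerivedCategory.singleFunctor A 0 ≅
          (tCoresolving P).heart.ι ⋙ toDerived P) := by
  have hF (X Y : DerivedCat P) (_ : (tCoresolving P).bounded X) (hY : (tCoresolving P).bounded Y) :
      Function.Bijective ((toDerived P).map : (X ⟶ Y) → _) := by
    -- Being bounded below for this t-structure means having a bounded below representing complex
    -- over `P`, so only the target matters.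
    obtain ⟨n, ⟨hn⟩⟩ := hY.1
    exact toDerived_map_bijective_of_strictGE_shift n X Y hn
  have hle (X : DerivedCat P) : (tCoresolving P).le 0 X ↔ ((toDerived P).obj X).IsLE 0 := by
    rw [← cohLE_iff]
    exact iff_of_eq (congr_fun ((cohLE P).shift_zero ℤ) X)
  obtain ⟨e, ⟨α⟩⟩ := HeartComparison.exists_heart_equivalence (tCoresolving P) (toDerived P) hF
    (fun X hX ↦ ⟨(hle X).1 hX.1, isGE_toDerived_obj_of_strictGE_shift P 0 X hX.2⟩)
    (fun a ↦ by
      -- A right resolution of `a` by objects of `P` represents the object of the heart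
      -- corresponding to `a`.
      obtain ⟨X, hX, ⟨e⟩⟩ := exists_strictGE_shift_iso (P := P) 0
        ((DerivedCategory.singleFunctor A 0).obj a) inferInstance
      exact ⟨X, ⟨(hle X).2 (DerivedCategory.TStructure.t.isLE_of_iso e 0), hX⟩, ⟨e.symm⟩⟩)
  exact ⟨HeartComparison.isOfDerivedType_of_heart_equivalence _ _ hF e α, e, ⟨α⟩⟩

lemma isOfDerivedType_tResolving (P : ObjectProperty A) [IsResolving P] :
    HeartComparison.IsOfDerivedType (tResolving P) ∧
      ∃ e : (tResolving P).heart.FullSubcategory ≌ A,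
        Nonempty (e.functor ⋙ DerivedCategory.singleFunctor A 0 ≅
          (tResolving P).heart.ι ⋙ toDerived P) := by
  have hF (X Y : DerivedCat P) (hX : (tResolving P).bounded X) (_ : (tResolving P).bounded Y) :
      Function.Bijective ((toDerived P).map : (X ⟶ Y) → _) := by
    -- In the resolving case it is the source that has a bounded above representing complex.
    obtain ⟨n, ⟨hn⟩⟩ := hX.2
    exact toDerived_map_bijective_of_strictLE_shift n X Y hn
  have hge (X : DerivedCat P) : (tResolving P).ge 0 X ↔ ((toDerived P).obj X).IsGE 0 := by
    rw [← cohGE_iff]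
    exact iff_of_eq (congr_fun ((cohGE P).shift_zero ℤ) X)
  obtain ⟨e, ⟨α⟩⟩ := HeartComparison.exists_heart_equivalence (tResolving P) (toDerived P) hF
    (fun X hX ↦ ⟨isLE_toDerived_obj_of_strictLE_shift P 0 X hX.1, (hge X).1 hX.2⟩)
    (fun a ↦ by
      obtain ⟨X, hX, ⟨e⟩⟩ := exists_strictLE_shift_iso (P := P) 0
        ((DerivedCategory.singleFunctor A 0).obj a) inferInstance
      exact ⟨X, ⟨hX, (hge X).2 (DerivedCategory.TStructure.t.isGE_of_iso e 0)⟩, ⟨e.symm⟩⟩)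
  exact ⟨HeartComparison.isOfDerivedType_of_heart_equivalence _ _ hF e α, e, ⟨α⟩⟩

end ExactDerived

end

theorem proposition5p4 :
    (∀ (A : Type u) [Category.{v} A] [Abelian A] [HasDerivedCategory.{w} A]
        (E : ObjectProperty A) [ExactDerived.IsCoresolving E],
      ∃ t : TStructure (ExactDerived.DerivedCat E),
        (∀ n : ℤ, t.le n = (ExactDerived.cohLE E).shift n) ∧
        (∀ n : ℤ, t.ge n = (ExactDerived.strictGE E).shift n) ∧
        HeartComparison.IsOfDerivedType t ∧
        ∃ e : t.heart.FullSubcategory ≌ A,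
          Nonempty (e.functor ⋙ DerivedCategory.singleFunctor A 0 ≅
            t.heart.ι ⋙ ExactDerived.toDerived E)) ∧
    (∀ (B : Type u) [Category.{v} B] [Abelian B] [HasDerivedCategory.{w} B]
        (F : ObjectProperty B) [ExactDerived.IsResolving F],
      ∃ t : TStructure (ExactDerived.DerivedCat F),
        (∀ n : ℤ, t.le n = (ExactDerived.strictLE F).shift n) ∧
        (∀ n : ℤ, t.ge n = (ExactDerived.cohGE F).shift n) ∧
        HeartComparison.IsOfDerivedType t ∧
        ∃ e : t.heart.FullSubcategory ≌ B,
          Nonempty (e.functor ⋙ DerivedCategory.singleFunctor B 0 ≅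
            t.heart.ι ⋙ ExactDerived.toDerived F)) := by
  exact ⟨fun A _ _ _ E _ ↦ ⟨ExactDerived.tCoresolving E, fun _ ↦ rfl, fun _ ↦ rfl,
      ExactDerived.isOfDerivedType_tCoresolving A E⟩,
    fun B _ _ _ F _ ↦ ⟨ExactDerived.tResolving F, fun _ ↦ rfl, fun _ ↦ rfl,
      ExactDerived.isOfDerivedType_tResolving B F⟩⟩
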